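/- For $m\ge 1$ let $\mathcal D_{\mathbb C^m}$ be the sheaf of linear differential operators with holomorphic coefficients on $\mathbb C^m$. For an integer row matrix $B=(b_1\ \cdots\ b_m)$ and $\beta\in\mathbb C$, let $H_B(\beta)$ be the left ideal of the Weyl algebra $\mathbb C[x_1,\dots,x_m]\langle\partial_1,\dots,\partial_m\rangle$ generated by the operators $\partial^{u_+}-\partial^{u_-}$ for $u\in\mathbb Z^m$ with $\sum_i b_iu_i=0$ (where $u=u_+-u_-$ with $u_+,u_-\in\mathbb N^m$ of disjoint supports) and by the Euler operator $\sum_i b_ix_i\partial_i-\beta$, and let $\mathcal M_B(\beta)=\mathcal D_{\mathbb C^m}/\mathcal D_{\mathbb C^m}H_B(\beta)$. **Theorem.** Let $1<a_1<\cdots<a_n$ be integers with $\gcd(a_1,\dots,a_n)=1$, let $A=(a_1\ \cdots\ a_n)$ and $A'=(1\ a_1\ \cdots\ a_n)$, and let $X'=\mathbb C^{n+1}$ with coordinates $x_0,x_1,\dots,x_n$ and $X=\{x_0=0\}\cong\mathbb C^n$. Then for each $\beta\in\mathbb C$ there exists $\beta'\in\mathbb C$ such that the restriction of $\mathcal M_{A'}(\beta)$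 to $X$, that is, the sheaf of left $\mathcal D_X$-modules $$\frac{\mathcal D_{X'}}{\mathcal D_{X'}H_{A'}(\beta)+x_0\mathcal D_{X'}}$$ (which is supported on $X$, and on which $\mathcal D_X$ acts by left multiplication by operators not involving $x_0$ and $\partial_0$), is isomorphic to $\mathcal M_A(\beta')$ as a sheaf of left $\mathcal D_X$-modules. Moreover, $\beta'$ can be chosen so that $\beta'=\beta$ for all but finitely many $\beta\in\mathbb C$. -/

import Mathlib

open Filter Topology CategoryTheory TopologicalSpace

noncomputable section

namespace HolD

/-- The space of germs at `p` of holomorphic functions on `ℂⁿ`, inside all germs of functions. -/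
def holGerms {n : ℕ} (p : Fin n → ℂ) : Submodule ℂ (Germ (𝓝 p) ℂ) where
  carrier := {g | ∃ f : (Fin n → ℂ) → ℂ, AnalyticAt ℂ f p ∧ (f : Germ (𝓝 p) ℂ) = g}
  add_mem' := by
    rintro _ _ ⟨f, hf, rfl⟩ ⟨g, hg, rfl⟩
    exact ⟨f + g, hf.add hg, rfl⟩
  zero_mem' := ⟨0, analyticAt_const, rfl⟩
  smul_mem' := by
    rintro c _ ⟨f, hf, rfl⟩
    exact ⟨c • f, analyticAt_const.smul hf, rfl⟩

/-- The stalk `𝒪_p` of germs at `p` of holomorphic functions on `ℂⁿ`. -/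
def HolGerm {n : ℕ} (p : Fin n → ℂ) : Type := holGerms p

instance {n : ℕ} (p : Fin n → ℂ) : AddCommGroup (HolGerm p) :=
  inferInstanceAs (AddCommGroup (holGerms p))

instance {n : ℕ} (p : Fin n → ℂ) : Module ℂ (HolGerm p) :=
  inferInstanceAs (Module ℂ (holGerms p))

/-- The germ at `p` of a function holomorphic at `p`. -/
def holGerm {n : ℕ} {p : Fin n → ℂ} (f : (Fin n → ℂ) → ℂ) (hf : AnalyticAt ℂ f p) : HolGerm p :=
  ⟨(f : Germ (𝓝 p) ℂ), f, hf, rfl⟩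

/-- Every holomorphic germ is the germ of a holomorphic function. -/
theorem HolGerm.ind {n : ℕ} {p : Fin n → ℂ} {motive : HolGerm p → Prop}
    (h : ∀ f hf, motive (holGerm f hf)) (g : HolGerm p) : motive g := by
  obtain ⟨_, f, hf, rfl⟩ := g
  exact h f hf

theorem holGerm_eq_iff {n : ℕ} {p : Fin n → ℂ} {f g : (Fin n → ℂ) → ℂ} {hf : AnalyticAt ℂ f p}
    {hg : AnalyticAt ℂ g p} : holGerm f hf = holGerm g hg ↔ f =ᶠ[𝓝 p] g := by
  rw [← Germ.coe_eq]
  exact Subtype.ext_iff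

/-- Multiplication by a function holomorphic at `p`, as an operator on `𝒪_p`. -/
def mulOp {n : ℕ} {p : Fin n → ℂ} (f : (Fin n → ℂ) → ℂ) (hf : AnalyticAt ℂ f p) :
    Module.End ℂ (HolGerm p) where
  toFun g := ⟨(f : Germ (𝓝 p) ℂ) * g.1, by
    obtain ⟨_, g, hg, rfl⟩ := g
    exact ⟨f * g, hf.mul hg, rfl⟩⟩
  map_add' g h := Subtype.ext (mul_add _ _ _)
  map_smul' c g := by
    induction g using HolGerm.ind with
    | h g hg =>
      exact Subtype.ext (Germ.coe_eq.2 (.of_forall fun x => mul_left_comm (f x) c (g x)))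

/-- The partial derivative `∂f/∂xᵢ` of a function on `ℂⁿ`. -/
def pderiv {n : ℕ} (i : Fin n) (f : (Fin n → ℂ) → ℂ) : (Fin n → ℂ) → ℂ :=
  fun x => fderiv ℂ f x (Pi.single i 1)

theorem analyticAt_pderiv {n : ℕ} (i : Fin n) {f : (Fin n → ℂ) → ℂ} {p : Fin n → ℂ}
    (hf : AnalyticAt ℂ f p) : AnalyticAt ℂ (pderiv i f) p :=
  ((ContinuousLinearMap.apply ℂ ℂ (Pi.single i 1 : Fin n → ℂ)).analyticAt _).comp hf.fderiv

theorem pderiv_congr {n : ℕ} (i : Fin n) {f g : (Fin n → ℂ) → ℂ} {p : Fin n → ℂ}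
    (h : f =ᶠ[𝓝 p] g) : pderiv i f =ᶠ[𝓝 p] pderiv i g := by
  filter_upwards [h.fderiv (𝕜 := ℂ)] with x hx
  simp only [pderiv, hx]

/-- The partial derivative `∂ᵢ`, as an operator on `𝒪_p`. -/
def partialOp {n : ℕ} {p : Fin n → ℂ} (i : Fin n) : Module.End ℂ (HolGerm p) where
  toFun g := ⟨Germ.map' (pderiv i)
      (fun _ _ h => pderiv_congr i h) g.1, by
    obtain ⟨_, g, hg, rfl⟩ := g
    exact ⟨pderiv i g, analyticAt_pderiv i hg, rfl⟩⟩
  map_add' g h := by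
    induction g using HolGerm.ind with
    | h g hg =>
      induction h using HolGerm.ind with
      | h h hh =>
        refine holGerm_eq_iff (hf := analyticAt_pderiv i (hg.add hh))
          (hg := (analyticAt_pderiv i hg).add (analyticAt_pderiv i hh)).2 ?_
        filter_upwards [hg.eventually_analyticAt, hh.eventually_analyticAt] with x hgx hhx
        simp [pderiv, fderiv_add hgx.differentiableAt hhx.differentiableAt]
  map_smul' c g := by
    induction g using HolGerm.ind with
    | h g hg =>
      refine holGerm_eq_iff (hf := analyticAt_pderiv i ((analyticAt_const (v := c)).smul hg))
          (hg := (analyticAt_const (v := c)).smul (analyticAt_pderiv i hg)).2 ?_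
      filter_upwards [hg.eventually_analyticAt] with x hgx
      change fderiv ℂ (c • g) x (Pi.single i 1) = c • fderiv ℂ g x (Pi.single i 1)
      rw [fderiv_const_smul hgx.differentiableAt]
      rfl

theorem mulOp_holGerm {n : ℕ} {p : Fin n → ℂ} {f g : (Fin n → ℂ) → ℂ} (hf : AnalyticAt ℂ f p)
    (hg : AnalyticAt ℂ g p) : mulOp f hf (holGerm g hg) = holGerm (f * g) (hf.mul hg) := rfl

theorem partialOp_holGerm {n : ℕ} {p : Fin n → ℂ} {g : (Fin n → ℂ) → ℂ} (i : Fin n)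
    (hg : AnalyticAt ℂ g p) :
    partialOp i (holGerm g hg) = holGerm (pderiv i g) (analyticAt_pderiv i hg) := rfl

/-- The algebra of operators on `𝒪_p` generated by the holomorphic functions and the `∂ᵢ`. -/
def diffOps {n : ℕ} (p : Fin n → ℂ) : Subalgebra ℂ (Module.End ℂ (HolGerm p)) :=
  Algebra.adjoin ℂ ({T | ∃ f, ∃ hf : AnalyticAt ℂ f p, T = mulOp f hf} ∪ Set.range partialOp)

/-- The ring `𝒟_p` of germs at `p` of linear differential operators with holomorphic
coefficients. -/
def DStalk {n : ℕ} (p : Fin n → ℂ) : Type := diffOps p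

instance {n : ℕ} (p : Fin n → ℂ) : Ring (DStalk p) := inferInstanceAs (Ring (diffOps p))

instance {n : ℕ} (p : Fin n → ℂ) : Algebra ℂ (DStalk p) := inferInstanceAs (Algebra ℂ (diffOps p))

/-- A function holomorphic at `p`, as an element of `𝒟_p`. -/
def mulD {n : ℕ} {p : Fin n → ℂ} (f : (Fin n → ℂ) → ℂ) (hf : AnalyticAt ℂ f p) : DStalk p :=
  ⟨mulOp f hf, Algebra.subset_adjoin (Or.inl ⟨f, hf, rfl⟩)⟩

/-- `∂ᵢ` as an element of `𝒟_p`. -/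
def partialD {n : ℕ} {p : Fin n → ℂ} (i : Fin n) : DStalk p :=
  ⟨partialOp i, Algebra.subset_adjoin (Or.inr ⟨i, rfl⟩)⟩

theorem analyticAt_coord {n : ℕ} (i : Fin n) (p : Fin n → ℂ) :
    AnalyticAt ℂ (fun x : Fin n → ℂ => x i) p :=
  (ContinuousLinearMap.proj (R := ℂ) (φ := fun _ : Fin n => ℂ) i).analyticAt p

/-- The coordinate function `xᵢ` as an element of `𝒟_p`. -/
def coordD {n : ℕ} {p : Fin n → ℂ} (i : Fin n) : DStalk p :=
  mulD (fun x => x i) (analyticAt_coord i p)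

/-! ### The hyperplane `x₀ = 0` in `ℂⁿ⁺¹` and the extension of operators from it -/

/-- The inclusion `ℂⁿ → ℂⁿ⁺¹`, `x ↦ (0, x)`. -/
def incl {n : ℕ} (x : Fin n → ℂ) : Fin (n + 1) → ℂ := Fin.cons 0 x

/-- `f(x₁, …, xₙ)` regarded as a function of `(x₀, x₁, …, xₙ)`. -/
def pull {n : ℕ} (f : (Fin n → ℂ) → ℂ) : (Fin (n + 1) → ℂ) → ℂ := fun x => f (Fin.tail x)

def tailL (n : ℕ) : (Fin (n + 1) → ℂ) →L[ℂ] (Fin n → ℂ) :=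
  ContinuousLinearMap.pi fun i => ContinuousLinearMap.proj i.succ

def inclL (n : ℕ) : (Fin n → ℂ) →L[ℂ] (Fin (n + 1) → ℂ) :=
  ContinuousLinearMap.pi (Fin.cons 0 fun i => ContinuousLinearMap.proj i)

theorem inclL_apply {n : ℕ} (x : Fin n → ℂ) : inclL n x = incl x := by
  ext i
  refine Fin.cases ?_ (fun j => ?_) i <;> simp [inclL, incl]

theorem analyticAt_incl {n : ℕ} (p : Fin n → ℂ) : AnalyticAt ℂ (incl (n := n)) p :=
  ((inclL n).analyticAt p).congr (.of_forall inclL_apply)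

theorem continuous_incl {n : ℕ} : Continuous (incl (n := n)) :=
  continuous_iff_continuousAt.2 fun p => (analyticAt_incl p).continuousAt

theorem tail_incl {n : ℕ} (x : Fin n → ℂ) : Fin.tail (incl x) = x := Fin.tail_cons _ _

theorem analyticAt_pull {n : ℕ} {f : (Fin n → ℂ) → ℂ} {y : Fin (n + 1) → ℂ}
    (hf : AnalyticAt ℂ f (Fin.tail y)) : AnalyticAt ℂ (pull f) y :=
  AnalyticAt.comp (g := f) (f := tailL n) hf ((tailL n).analyticAt y)

theorem analyticAt_pull_incl {n : ℕ} {f : (Fin n → ℂ) → ℂ} {p : Fin n → ℂ}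
    (hf : AnalyticAt ℂ f p) : AnalyticAt ℂ (pull f) (incl p) :=
  analyticAt_pull (by rwa [tail_incl])

/-- The graph of the ring homomorphism `𝒟_{ℂⁿ,p} → 𝒟_{ℂⁿ⁺¹,(0,p)}` that regards an operator in
`x₁, …, xₙ` as an operator in `x₀, x₁, …, xₙ` not involving `x₀` and `∂₀`. -/
def liftGraph {n : ℕ} (p : Fin n → ℂ) : Subalgebra ℂ (DStalk (incl p) × DStalk p) :=
  Algebra.adjoin ℂ
    ({T | ∃ f, ∃ hf : AnalyticAt ℂ f p, T = (mulD (pull f) (analyticAt_pull_incl hf), mulD f hf)} ∪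
      Set.range fun i => (partialD i.succ, partialD i))

/-- Restriction of germs of holomorphic functions to the hyperplane. -/
def restrGerm {n : ℕ} (p : Fin n → ℂ) : HolGerm (incl p) →ₗ[ℂ] HolGerm p where
  toFun g := ⟨g.1.compTendsto incl continuous_incl.continuousAt, by
    obtain ⟨_, g, hg, rfl⟩ := g
    exact ⟨g ∘ incl, hg.comp (analyticAt_incl p), rfl⟩⟩
  map_add' g h := by
    obtain ⟨_, g, hg, rfl⟩ := g
    obtain ⟨_, h, hh, rfl⟩ := h
    rfl
  map_smul' c g := by
    obtain ⟨_, g, hg, rfl⟩ := g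
    rfl

theorem restrGerm_holGerm {n : ℕ} {p : Fin n → ℂ} {g : (Fin (n + 1) → ℂ) → ℂ}
    (hg : AnalyticAt ℂ g (incl p)) :
    restrGerm p (holGerm g hg) = holGerm (g ∘ incl) (hg.comp (analyticAt_incl p)) := rfl

theorem partialOp_mulOp_pull {n : ℕ} {p : Fin n → ℂ} {f : (Fin n → ℂ) → ℂ}
    (hf : AnalyticAt ℂ f p) :
    partialOp 0 * mulOp (pull f) (analyticAt_pull_incl hf) =
      mulOp (pull f) (analyticAt_pull_incl hf) * partialOp 0 := by
  ext1 g
  induction g using HolGerm.ind with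
  | h g hg =>
    refine holGerm_eq_iff (hf := analyticAt_pderiv 0 ((analyticAt_pull_incl hf).mul hg))
      (hg := (analyticAt_pull_incl hf).mul (analyticAt_pderiv 0 hg)).2 ?_
    filter_upwards [(analyticAt_pull_incl hf).eventually_analyticAt, hg.eventually_analyticAt,
      (tailL n).continuous.continuousAt.eventually
        (show ∀ᶠ x in 𝓝 (tailL n (incl p)), AnalyticAt ℂ f x from by
          rw [show tailL n (incl p) = p from tail_incl p]
          exact hf.eventually_analyticAt)] with x h1 h2 h3
    have h4 : fderiv ℂ (pull f) x = (fderiv ℂ f (tailL n x)).comp (tailL n) := by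
      have := fderiv_comp x (g := f) (f := tailL n) h3.differentiableAt
        (tailL n).differentiableAt
      rwa [(tailL n).fderiv] at this
    have h5 : tailL n (Pi.single 0 1) = 0 := by
      ext j
      simp [tailL]
    simp [pderiv, fderiv_mul h1.differentiableAt h2.differentiableAt, h4, h5]

theorem partialOp_comm {n : ℕ} {p : Fin n → ℂ} (i j : Fin n) :
    (partialOp i * partialOp j : Module.End ℂ (HolGerm p)) = partialOp j * partialOp i := by
  ext1 g
  induction g using HolGerm.ind with
  | h g hg =>
    refine holGerm_eq_iff (hf := analyticAt_pderiv i (analyticAt_pderiv j hg))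
      (hg := analyticAt_pderiv j (analyticAt_pderiv i hg)).2 ?_
    filter_upwards [hg.eventually_analyticAt] with x hx
    have key : ∀ v w : Fin n → ℂ, fderiv ℂ (fun y => fderiv ℂ g y v) x w =
        fderiv ℂ (fderiv ℂ g) x w v := by
      intro v w
      rw [fderiv_clm_apply hx.fderiv.differentiableAt (differentiableAt_const _)]
      simp
    change fderiv ℂ (fun y => fderiv ℂ g y _) x _ = fderiv ℂ (fun y => fderiv ℂ g y _) x _
    rw [key, key]
    exact (hx.contDiffAt.isSymmSndFDerivAt_of_omega).eq _ _

theorem restrGerm_partialOp {n : ℕ} {p : Fin n → ℂ} (i : Fin n) (g : HolGerm (incl p)) :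
    restrGerm p (partialOp i.succ g) = partialOp i (restrGerm p g) := by
  induction g using HolGerm.ind with
  | h g hg =>
    refine holGerm_eq_iff (hf := (analyticAt_pderiv i.succ hg).comp (analyticAt_incl p))
      (hg := analyticAt_pderiv i (hg.comp (analyticAt_incl p))).2 ?_
    filter_upwards [continuous_incl.continuousAt.eventually hg.eventually_analyticAt] with x hx
    have e : (g ∘ incl) = g ∘ inclL n := by
      ext y
      simp [inclL_apply]
    have h1 : fderiv ℂ (g ∘ inclL n) x = (fderiv ℂ g (inclL n x)).comp (inclL n) := by
      have := fderiv_comp x (g := g) (f := inclL n)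
        (by rw [inclL_apply]; exact hx.differentiableAt) (inclL n).differentiableAt
      rwa [(inclL n).fderiv] at this
    have h2 : inclL n (Pi.single i 1) = Pi.single i.succ 1 := by
      rw [inclL_apply]
      ext j
      refine Fin.cases ?_ (fun j => ?_) j
      · simp [incl]
      · simp [incl, Pi.single_apply]
    simp [pderiv, e, h1, h2, inclL_apply]

theorem liftGraph_spec {n : ℕ} {p : Fin n → ℂ} {T : DStalk (incl p) × DStalk p}
    (hT : T ∈ liftGraph p) : ∀ (k : ℕ) (g : HolGerm (incl p)),
      restrGerm p ((partialOp 0 ^ k) (T.1.1 g)) = T.2.1 (restrGerm p ((partialOp 0 ^ k) g)) := by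
  induction hT using Algebra.adjoin_induction with
  | mem T hT =>
    intro k g
    obtain ⟨f, hf, rfl⟩ | ⟨i, rfl⟩ := hT
    · have h1 : Commute (partialOp 0 ^ k) (mulOp (pull f) (analyticAt_pull_incl hf)) :=
        Commute.pow_left (partialOp_mulOp_pull hf) k
      have h2 := LinearMap.congr_fun h1.eq g
      simp only [Module.End.mul_apply] at h2
      change restrGerm p ((partialOp 0 ^ k) (mulOp _ (analyticAt_pull_incl hf) g)) = mulOp f hf _
      rw [h2]
      generalize (partialOp 0 ^ k) g = g'
      induction g' using HolGerm.ind with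
      | h g hg =>
        refine holGerm_eq_iff
          (hf := ((analyticAt_pull_incl hf).mul hg).comp (analyticAt_incl p))
          (hg := hf.mul (hg.comp (analyticAt_incl p))).2 (.of_forall fun x => ?_)
        simp [pull, tail_incl]
    · have h1 : Commute (partialOp 0 ^ k) (partialOp i.succ : Module.End ℂ (HolGerm (incl p))) :=
        Commute.pow_left (partialOp_comm _ _) k
      have h2 := LinearMap.congr_fun h1.eq g
      simp only [Module.End.mul_apply] at h2
      change restrGerm p ((partialOp 0 ^ k) (partialOp _ g)) = partialOp _ _
      rw [h2, restrGerm_partialOp]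
  | algebraMap r =>
    intro k g
    change restrGerm p ((partialOp 0 ^ k) (r • g)) = r • _
    rw [map_smul, map_smul]
    rfl
  | add S T _ _ hS hT =>
    intro k g
    change restrGerm p ((partialOp 0 ^ k) (S.1.1 g + T.1.1 g)) = S.2.1 _ + T.2.1 _
    rw [map_add, map_add, hS, hT]
  | mul S T _ _ hS hT =>
    intro k g
    change restrGerm p ((partialOp 0 ^ k) (S.1.1 (T.1.1 g))) = S.2.1 (T.2.1 _)
    rw [hS, hT]

/-- A holomorphic germ is determined by the restrictions of its derivatives in `x₀`. -/
theorem eq_zero_of_restrGerm {n : ℕ} {p : Fin n → ℂ} (g : HolGerm (incl p))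
    (h : ∀ k : ℕ, restrGerm p ((partialOp 0 ^ k) g) = 0) : g = 0 := by
  induction g using HolGerm.ind with
  | h g hg =>
    obtain ⟨r, hr, hB⟩ := Metric.eventually_nhds_iff_ball.1 hg.eventually_analyticAt
    have hpow : ∀ k, ∀ y ∈ Metric.ball (incl p) r, AnalyticAt ℂ ((pderiv 0)^[k] g) y := by
      intro k
      induction k with
      | zero => exact hB
      | succ k ih =>
        intro y hy
        rw [Function.iterate_succ_apply']
        exact analyticAt_pderiv 0 (ih y hy)
    have hgerm : ∀ k, (partialOp 0 ^ k) (holGerm g hg) =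
        holGerm ((pderiv 0)^[k] g) (hpow k _ (Metric.mem_ball_self hr)) := by
      intro k
      induction k with
      | zero => rfl
      | succ k ih =>
        rw [pow_succ', Module.End.mul_apply, ih, partialOp_holGerm]
        simp only [Function.iterate_succ_apply']
    have hmem : ∀ (c : ℂ) (x : Fin n → ℂ), c ∈ Metric.ball (0 : ℂ) r → x ∈ Metric.ball p r →
        (Fin.cons c x : Fin (n + 1) → ℂ) ∈ Metric.ball (incl p) r := by
      intro c x hc hx
      rw [Metric.mem_ball, dist_pi_lt_iff hr]
      intro j
      refine Fin.cases ?_ (fun j => ?_) j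
      · simpa [incl] using hc
      · simpa [incl] using (dist_pi_lt_iff hr).1 hx j
    have hzero : ∀ k, ∀ x ∈ Metric.ball p r, (pderiv 0)^[k] g (incl x) = 0 := by
      intro k
      have hk := h k
      rw [hgerm, restrGerm_holGerm] at hk
      have hk' := (holGerm_eq_iff (hg := analyticAt_const (v := (0 : ℂ)))).1 hk
      have han : AnalyticOnNhd ℂ (((pderiv 0)^[k] g) ∘ incl) (Metric.ball p r) := fun x hx =>
        AnalyticAt.comp (hpow k _ (hmem 0 x (Metric.mem_ball_self hr) hx)) (analyticAt_incl x)
      exact fun x hx => han.eqOn_zero_of_preconnected_of_eventuallyEq_zero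
        (convex_ball p r).isPreconnected (Metric.mem_ball_self hr) hk' hx
    refine (holGerm_eq_iff (hg := analyticAt_const (v := (0 : ℂ)))).2 ?_
    filter_upwards [Metric.ball_mem_nhds _ hr] with y hy
    have hy' := (dist_pi_lt_iff hr).1 hy
    have hy0 : y 0 ∈ Metric.ball (0 : ℂ) r := by simpa [incl] using hy' 0
    have hyt : Fin.tail y ∈ Metric.ball p r := by
      rw [Metric.mem_ball, dist_pi_lt_iff hr]
      intro j
      simpa [incl, Fin.tail] using hy' j.succ
    set x := Fin.tail y with hx
    have hline : ∀ c : ℂ, HasDerivAt (fun c : ℂ => (Fin.cons c x : Fin (n + 1) → ℂ))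
        (Pi.single 0 1) c := by
      intro c
      rw [hasDerivAt_pi]
      intro j
      refine Fin.cases ?_ (fun j => ?_) j
      · exact hasDerivAt_id c
      · simpa using hasDerivAt_const c (x j)
    have hder : ∀ k, ∀ c ∈ Metric.ball (0 : ℂ) r,
        HasDerivAt (fun c => (pderiv 0)^[k] g (Fin.cons c x))
          ((pderiv 0)^[k + 1] g (Fin.cons c x)) c := by
      intro k c hc
      rw [Function.iterate_succ_apply']
      exact (hpow k _ (hmem c x hc hyt)).differentiableAt.hasFDerivAt.comp_hasDerivAt c (hline c)
    have hiter : ∀ k, ∀ c ∈ Metric.ball (0 : ℂ) r,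
        iteratedDeriv k (fun c => g (Fin.cons c x)) c = (pderiv 0)^[k] g (Fin.cons c x) := by
      intro k
      induction k with
      | zero => intro c _; simp
      | succ k ih =>
        intro c hc
        rw [iteratedDeriv_succ, ← (hder k c hc).deriv]
        refine EventuallyEq.deriv_eq ?_
        filter_upwards [Metric.isOpen_ball.mem_nhds hc] with c' hc' using ih c' hc'
    have hd : DifferentiableOn ℂ (fun c => g (Fin.cons c x)) (Metric.ball (0 : ℂ) r) :=
      fun c hc => (hder 0 c hc).differentiableAt.differentiableWithinAt
    have ht := Complex.taylorSeries_eq_on_ball hd hy0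
    have hcons : (Fin.cons (y 0) x : Fin (n + 1) → ℂ) = y := Fin.cons_self_tail y
    rw [hcons] at ht
    rw [← ht]
    have : ∀ k, iteratedDeriv k (fun c => g (Fin.cons c x)) 0 = 0 := fun k => by
      rw [hiter k 0 (Metric.mem_ball_self hr)]
      exact hzero k x hyt
    simp [this]

theorem liftGraph_snd_bijective {n : ℕ} (p : Fin n → ℂ) :
    Function.Bijective ((AlgHom.snd ℂ (DStalk (incl p)) (DStalk p)).comp (liftGraph p).val) := by
  constructor
  · rintro ⟨⟨T, S⟩, hT⟩ ⟨⟨T', S'⟩, hT'⟩ (h : S = S')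
    subst h
    have : T = T' := by
      refine Subtype.ext (LinearMap.ext fun g => sub_eq_zero.1 ?_)
      refine eq_zero_of_restrGerm _ fun k => ?_
      rw [map_sub, map_sub, liftGraph_spec hT, liftGraph_spec hT', sub_self]
    subst this
    rfl
  · rintro ⟨S, hS⟩
    suffices h : ∃ T, (T, (⟨S, hS⟩ : DStalk p)) ∈ liftGraph p by
      obtain ⟨T, hT⟩ := h
      exact ⟨⟨_, hT⟩, rfl⟩
    induction hS using Algebra.adjoin_induction with
    | mem S hS =>
      obtain ⟨f, hf, rfl⟩ | ⟨i, rfl⟩ := hS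
      · exact ⟨_, Algebra.subset_adjoin (Or.inl ⟨f, hf, rfl⟩)⟩
      · exact ⟨_, Algebra.subset_adjoin (Or.inr ⟨i, rfl⟩)⟩
    | algebraMap r => exact ⟨_, (liftGraph p).algebraMap_mem r⟩
    | add x y _ _ hx hy =>
      obtain ⟨T, hT⟩ := hx
      obtain ⟨S, hS⟩ := hy
      exact ⟨_, (liftGraph p).add_mem hT hS⟩
    | mul x y _ _ hx hy =>
      obtain ⟨T, hT⟩ := hx
      obtain ⟨S, hS⟩ := hy
      exact ⟨_, (liftGraph p).mul_mem hT hS⟩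

/-- The ring homomorphism `𝒟_{ℂⁿ,p} → 𝒟_{ℂⁿ⁺¹,(0,p)}` with `f(x) ↦ f(x)` and `∂ᵢ ↦ ∂ᵢ`; the
coordinate `xᵢ` of `ℂⁿ` is the coordinate with index `i.succ` of `ℂⁿ⁺¹`. -/
def liftD {n : ℕ} (p : Fin n → ℂ) : DStalk p →ₐ[ℂ] DStalk (incl p) :=
  ((AlgHom.fst ℂ (DStalk (incl p)) (DStalk p)).comp (liftGraph p).val).comp
    (AlgEquiv.ofBijective _ (liftGraph_snd_bijective p)).symm.toAlgHom

theorem liftD_eq {n : ℕ} {p : Fin n → ℂ} {T : DStalk (incl p)} {S : DStalk p}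
    (h : (T, S) ∈ liftGraph p) : liftD p S = T := by
  have : (AlgEquiv.ofBijective _ (liftGraph_snd_bijective p)).symm S = ⟨(T, S), h⟩ := by
    rw [AlgEquiv.symm_apply_eq]
    rfl
  change ((AlgEquiv.ofBijective _ (liftGraph_snd_bijective p)).symm S).1.1 = T
  rw [this]

theorem liftD_mulD {n : ℕ} {p : Fin n → ℂ} {f : (Fin n → ℂ) → ℂ} (hf : AnalyticAt ℂ f p) :
    liftD p (mulD f hf) = mulD (pull f) (analyticAt_pull_incl hf) :=
  liftD_eq (Algebra.subset_adjoin (Or.inl ⟨f, hf, rfl⟩))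

theorem liftD_partialD {n : ℕ} {p : Fin n → ℂ} (i : Fin n) :
    liftD p (partialD i) = partialD i.succ :=
  liftD_eq (Algebra.subset_adjoin (Or.inr ⟨i, rfl⟩))

/-! ### The sheaf of differential operators -/

/-- The complex manifold `ℂⁿ` as a topological space. -/
abbrev X (n : ℕ) : TopCat := TopCat.of (Fin n → ℂ)

/-- The operator `f` over an open set on which `f` is holomorphic. -/
def mulSec {n : ℕ} (U : Opens (X n)) (f : (Fin n → ℂ) → ℂ) (hf : ∀ x ∈ U, AnalyticAt ℂ f x) :
    ∀ x : U, DStalk (x.1 : Fin n → ℂ) :=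
  fun x => mulD f (hf x.1 x.2)

/-- The operators over `U` that are noncommutative polynomials in holomorphic functions on `U` and
in `∂₁, …, ∂ₙ`, each regarded as the family of its germs. -/
def basicSections {n : ℕ} (U : Opens (X n)) :
    Subalgebra ℂ (∀ x : U, DStalk (x.1 : Fin n → ℂ)) :=
  Algebra.adjoin ℂ ({P | ∃ f, ∃ hf : ∀ x ∈ U, AnalyticAt ℂ f x, P = mulSec U f hf} ∪
    Set.range fun i _ => partialD i)

theorem basicSections_res {n : ℕ} {U V : Opens (X n)} (i : U ⟶ V)
    {P : ∀ x : V, DStalk (x.1 : Fin n → ℂ)} (hP : P ∈ basicSections V) :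
    (fun x : U => P ⟨x.1, i.le x.2⟩) ∈ basicSections U := by
  induction hP using Algebra.adjoin_induction with
  | mem P hP =>
    obtain ⟨f, hf, rfl⟩ | ⟨j, rfl⟩ := hP
    · exact Algebra.subset_adjoin (Or.inl ⟨f, fun x hx => hf x (i.le hx), rfl⟩)
    · exact Algebra.subset_adjoin (Or.inr ⟨j, rfl⟩)
  | algebraMap r => exact (basicSections U).algebraMap_mem r
  | add P Q _ _ hP hQ => exact (basicSections U).add_mem hP hQ
  | mul P Q _ _ hP hQ => exact (basicSections U).mul_mem hP hQ

def basicPrelocal (n : ℕ) : TopCat.PrelocalPredicate fun x : X n => DStalk (x : Fin n → ℂ) where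
  pred {U} P := P ∈ basicSections U
  res i _ hP := basicSections_res i hP

/-- The sections over `U` of the sheaf `𝒟` of linear differential operators with holomorphic
coefficients, each given by the family of its germs. -/
def DSections {n : ℕ} (U : Opens (X n)) : Subalgebra ℂ (∀ x : U, DStalk (x.1 : Fin n → ℂ)) where
  carrier := {P | (basicPrelocal n).sheafify.pred P}
  mul_mem' hP hQ := TopCat.PrelocalPredicate.sheafify_inductionOn₂' _ _ _ (fun a b => a * b)
    (fun ha hb => (basicSections _).mul_mem (basicSections_res (Opens.infLELeft _ _) ha)
      (basicSections_res (Opens.infLERight _ _) hb)) hP hQ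
  add_mem' hP hQ := TopCat.PrelocalPredicate.sheafify_inductionOn₂' _ _ _ (fun a b => a + b)
    (fun ha hb => (basicSections _).add_mem (basicSections_res (Opens.infLELeft _ _) ha)
      (basicSections_res (Opens.infLERight _ _) hb)) hP hQ
  algebraMap_mem' r := TopCat.PrelocalPredicate.sheafifyOf ((basicSections U).algebraMap_mem r)

theorem basicSections_le {n : ℕ} (U : Opens (X n)) : basicSections U ≤ DSections U :=
  fun _ hP => TopCat.PrelocalPredicate.sheafifyOf hP

theorem DSections_res {n : ℕ} {U V : Opens (X n)} (h : U ≤ V)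
    {P : ∀ x : V, DStalk (x.1 : Fin n → ℂ)} (hP : P ∈ DSections V) :
    (fun x : U => P ⟨x.1, h x.2⟩) ∈ DSections U :=
  (basicPrelocal n).sheafify.res (homOfLE h) P hP

/-- The presheaf of rings underlying `𝒟`. -/
def DPresheaf (n : ℕ) : TopCat.Presheaf RingCat (X n) where
  obj U := RingCat.of (DSections U.unop)
  map i := RingCat.ofHom
    { toFun P := ⟨fun x => P.1 ⟨x.1, i.unop.le x.2⟩, DSections_res i.unop.le P.2⟩
      map_one' := rfl
      map_mul' _ _ := rfl
      map_zero' := rfl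
      map_add' _ _ := rfl }
  map_id _ := rfl
  map_comp _ _ := rfl

def DPresheafForgetIso (n : ℕ) : (TopCat.subsheafToTypes (basicPrelocal n).sheafify).obj ≅
    DPresheaf n ⋙ forget RingCat :=
  NatIso.ofComponents (fun _ => Iso.refl _) fun _ => rfl

/-- The sheaf of rings `𝒟` on `ℂⁿ` of linear differential operators with holomorphic
coefficients. -/
def DSheaf (n : ℕ) : TopCat.Sheaf RingCat (X n) :=
  ⟨DPresheaf n, (TopCat.Presheaf.isSheaf_iff_isSheaf_comp (forget RingCat) _).2
    (TopCat.Presheaf.isSheaf_of_iso (DPresheafForgetIso n)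
      (TopCat.subsheafToTypes (basicPrelocal n).sheafify).property)⟩

/-! ### Sheaves of modules with prescribed stalks -/

/-- Mathlib's category of sheaves of left `𝒟`-modules, with the universe levels made explicit. -/
instance instCategoryDMod (n : ℕ) : Category.{0, 1} (SheafOfModules.{0} (DSheaf n)) :=
  SheafOfModules.instCategory.{0, 0, 0, 0}

section

variable {n : ℕ} (N : X n → Type) [∀ x, AddCommGroup (N x)]
  [∀ x, Module (DStalk (x : Fin n → ℂ)) (N x)] (B : TopCat.PrelocalPredicate N)
  (h0 : ∀ U : Opens (X n), B.pred (0 : ∀ x : U, N x))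
  (hadd : ∀ {U : Opens (X n)} {s t : ∀ x : U, N x}, B.pred s → B.pred t → B.pred (s + t))
  (hsmul : ∀ {U : Opens (X n)} {P : ∀ x : U, DStalk (x.1 : Fin n → ℂ)} {s : ∀ x : U, N x},
    P ∈ basicSections U → B.pred s → B.pred fun x => P x • s x)

/-- The families of germs over `U` that locally belong to `B`. -/
def modSections (U : Opens (X n)) : Submodule (DSections U) (∀ x : U, N x) where
  carrier := {s | B.sheafify.pred s}
  zero_mem' := TopCat.PrelocalPredicate.sheafifyOf (h0 U)
  add_mem' hs ht := TopCat.PrelocalPredicate.sheafify_inductionOn₂' _ _ _ (fun a b => a + b)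
    (fun ha hb => hadd (B.res (Opens.infLELeft _ _) _ ha) (B.res (Opens.infLERight _ _) _ hb)) hs ht
  smul_mem' P _ hs := TopCat.PrelocalPredicate.sheafify_inductionOn₂' (basicPrelocal n) _ _
    (fun a b => a • b) (fun ha hb => hsmul (basicSections_res (Opens.infLELeft _ _) ha)
      (B.res (Opens.infLERight _ _) _ hb)) P.2 hs

instance modSectionsModule (U : (Opens (X n))ᵒᵖ) :
    Module ((DSheaf n).obj.obj U) (modSections N B h0 hadd hsmul U.unop) :=
  inferInstanceAs (Module (DSections U.unop) (modSections N B h0 hadd hsmul U.unop))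

/-- The presheaf of `𝒟`-modules underlying `modSheaf`. -/
def modPresheaf : PresheafOfModules (DSheaf n).obj where
  obj U := ModuleCat.of ((DSheaf n).obj.obj U) (modSections N B h0 hadd hsmul U.unop)
  map {U V} i := ModuleCat.semilinearMapAddEquiv ((DSheaf n).obj.map i).hom
    (ModuleCat.of ((DSheaf n).obj.obj U) (modSections N B h0 hadd hsmul U.unop))
    (ModuleCat.of ((DSheaf n).obj.obj V) (modSections N B h0 hadd hsmul V.unop))
    { toFun s := ⟨fun x => s.1 ⟨x.1, i.unop.le x.2⟩, B.sheafify.res i.unop s.1 s.2⟩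
      map_add' _ _ := rfl
      map_smul' _ _ := rfl }
  map_id _ := rfl
  map_comp _ _ := rfl

def modPresheafForgetIso : (TopCat.subsheafToTypes B.sheafify).obj ≅
    (modPresheaf N B h0 hadd hsmul).presheaf ⋙ forget Ab :=
  NatIso.ofComponents (fun _ => Iso.refl _) fun _ => rfl

/-- The sheaf of left `𝒟`-modules whose sections over `U` are the families `(sₓ)`, `sₓ ∈ N x`,
that locally belong to `B`. -/
def modSheaf : SheafOfModules (DSheaf n) where
  val := modPresheaf N B h0 hadd hsmul
  isSheaf := (TopCat.Presheaf.isSheaf_iff_isSheaf_comp (forget Ab) _).2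
    (TopCat.Presheaf.isSheaf_of_iso (modPresheafForgetIso N B h0 hadd hsmul)
      (TopCat.subsheafToTypes B.sheafify).property)

end

/-! ### Hypergeometric systems -/

/-- The Weyl algebra `Aₙ`: the differential operators on `ℂⁿ` with polynomial coefficients. -/
def Weyl (n : ℕ) : Subalgebra ℂ (∀ p : Fin n → ℂ, DStalk p) :=
  Algebra.adjoin ℂ ((Set.range fun i _ => coordD i) ∪ Set.range fun i _ => partialD i)

/-- `xᵢ` in the Weyl algebra. -/
def wx {n : ℕ} (i : Fin n) : Weyl n :=
  ⟨fun _ => coordD i, Algebra.subset_adjoin (Or.inl ⟨i, rfl⟩)⟩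

/-- `∂ᵢ` in the Weyl algebra. -/
def wd {n : ℕ} (i : Fin n) : Weyl n :=
  ⟨fun _ => partialD i, Algebra.subset_adjoin (Or.inr ⟨i, rfl⟩)⟩

/-- The monomial `∂₁^{k₁} ⋯ ∂ₙ^{kₙ}`. -/
def wdPow {n : ℕ} (k : Fin n → ℕ) : Weyl n := (List.ofFn fun i => wd i ^ k i).prod

/-- The binomial `∂^{u₊} - ∂^{u₋}`. -/
def toricOp {n : ℕ} (u : Fin n → ℤ) : Weyl n :=
  wdPow (fun i => (u i).toNat) - wdPow (fun i => (-u i).toNat)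

/-- The Euler operator `∑ aᵢ xᵢ ∂ᵢ - β` of the row matrix `a = (a₁ … aₙ)`. -/
def eulerOp {n : ℕ} (a : Fin n → ℤ) (β : ℂ) : Weyl n :=
  (∑ i, (a i : ℂ) • (wx i * wd i)) - algebraMap ℂ (Weyl n) β

/-- The hypergeometric ideal `H_a(β)`, a left ideal of the Weyl algebra. -/
def hypIdeal {n : ℕ} (a : Fin n → ℤ) (β : ℂ) : Submodule (Weyl n) (Weyl n) :=
  Submodule.span (Weyl n) ({P | ∃ u : Fin n → ℤ, ∑ i, a i * u i = 0 ∧ P = toricOp u} ∪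
    {eulerOp a β})

/-- The stalk at `p` of the sheaf of left ideals `𝒟 H_a(β)`. -/
def hypStalk {n : ℕ} (a : Fin n → ℤ) (β : ℂ) (p : Fin n → ℂ) : Submodule (DStalk p) (DStalk p) :=
  Submodule.span (DStalk p) ((fun P : Weyl n => P.1 p) '' (hypIdeal a β))

/-- The stalk at `p` of `𝒟 / 𝒟 H_a(β)`. -/
abbrev HypMod {n : ℕ} (a : Fin n → ℤ) (β : ℂ) (p : Fin n → ℂ) : Type :=
  DStalk p ⧸ hypStalk a β p

/-- The families of germs that are classes of a section of `𝒟`. -/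
def hypPrelocal {n : ℕ} (a : Fin n → ℤ) (β : ℂ) :
    TopCat.PrelocalPredicate fun x : X n => HypMod a β x where
  pred {U} s := ∃ P ∈ DSections U, ∀ x : U, s x = Submodule.Quotient.mk (P x)
  res := by
    rintro U V i s ⟨P, hP, hs⟩
    exact ⟨_, DSections_res i.le hP, fun x => hs _⟩

/-- The analytic hypergeometric `𝒟`-module `ℳ_a(β) = 𝒟 / 𝒟 H_a(β)` on `ℂⁿ`. -/
def hypSheaf {n : ℕ} (a : Fin n → ℤ) (β : ℂ) : SheafOfModules (DSheaf n) :=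
  modSheaf (fun x : X n => HypMod a β x) (hypPrelocal a β)
    (fun U => ⟨0, (DSections U).zero_mem, fun _ => rfl⟩)
    (by
      rintro U s t ⟨P, hP, hs⟩ ⟨Q, hQ, ht⟩
      exact ⟨P + Q, (DSections U).add_mem hP hQ, fun x => by
        rw [Pi.add_apply, hs, ht]
        rfl⟩)
    (by
      rintro U P s hP ⟨Q, hQ, hs⟩
      exact ⟨P * Q, (DSections U).mul_mem (basicSections_le U hP) hQ, fun x => by
        change P x • s x = _
        rw [hs]
        rfl⟩)

/-! ### Restriction to the hyperplane `x₀ = 0` -/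

/-- The action of `𝒟_{ℂⁿ,p}` on `𝒟_{ℂⁿ⁺¹,(0,p)}` by left multiplication with operators not
involving `x₀` and `∂₀`. -/
instance liftModule {n : ℕ} (p : Fin n → ℂ) : Module (DStalk p) (DStalk (incl p)) :=
  Module.compHom _ (liftD p).toRingHom

theorem lift_smul_def {n : ℕ} {p : Fin n → ℂ} (P : DStalk p) (Q : DStalk (incl p)) :
    P • Q = liftD p P * Q := rfl

/-- Operators not involving `x₀` and `∂₀` commute with `x₀`. -/
theorem liftD_coordD {n : ℕ} {p : Fin n → ℂ} (P : DStalk p) :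
    liftD p P * coordD 0 = coordD 0 * liftD p P := by
  obtain ⟨S, hS⟩ := P
  induction hS using Algebra.adjoin_induction with
  | mem S hS =>
    obtain ⟨f, hf, rfl⟩ | ⟨i, rfl⟩ := hS
    · refine (congrArg (· * coordD 0) (liftD_mulD hf)).trans
        (Eq.trans ?_ (congrArg (coordD 0 * ·) (liftD_mulD hf)).symm)
      exact Subtype.ext (LinearMap.ext fun g => Subtype.ext (mul_left_comm _ _ _))
    · refine (congrArg (· * coordD 0) (liftD_partialD i)).trans
        (Eq.trans ?_ (congrArg (coordD 0 * ·) (liftD_partialD i)).symm)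
      refine Subtype.ext (LinearMap.ext fun g => ?_)
      induction g using HolGerm.ind with
      | h g hg =>
        refine holGerm_eq_iff
          (hf := analyticAt_pderiv i.succ ((analyticAt_coord 0 (incl p)).mul hg))
          (hg := (analyticAt_coord 0 (incl p)).mul (analyticAt_pderiv i.succ hg)).2 ?_
        filter_upwards [hg.eventually_analyticAt] with x hx
        have h1 : fderiv ℂ (fun x : Fin (n + 1) → ℂ => x 0) x =
            ContinuousLinearMap.proj (R := ℂ) (φ := fun _ : Fin (n + 1) => ℂ) 0 :=
          (ContinuousLinearMap.proj (R := ℂ) (φ := fun _ : Fin (n + 1) => ℂ) 0).fderiv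
        simp [pderiv, fderiv_mul (analyticAt_coord 0 x).differentiableAt hx.differentiableAt, h1]
  | algebraMap r =>
    refine (congrArg (· * coordD 0) ((liftD p).commutes r)).trans
      (Eq.trans ?_ (congrArg (coordD 0 * ·) ((liftD p).commutes r)).symm)
    exact Algebra.commutes _ _
  | add S T hS hT h1 h2 =>
    have e := map_add (liftD p) ⟨S, hS⟩ ⟨T, hT⟩
    refine (congrArg (· * coordD 0) e).trans (Eq.trans ?_ (congrArg (coordD 0 * ·) e).symm)
    simp only [add_mul, mul_add, h1, h2]
  | mul S T hS hT h1 h2 =>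
    have e := map_mul (liftD p) ⟨S, hS⟩ ⟨T, hT⟩
    refine (congrArg (· * coordD 0) e).trans (Eq.trans ?_ (congrArg (coordD 0 * ·) e).symm)
    simp only [mul_assoc, h2]
    simp only [← mul_assoc, h1]

/-- The stalk at `(0, p)` of `𝒟 H_{a'}(β) + x₀ 𝒟`, for `𝒟` the sheaf of differential operators on
`ℂⁿ⁺¹`; it is stable under `𝒟_{ℂⁿ,p}`. -/
def restrStalk {n : ℕ} (a' : Fin (n + 1) → ℤ) (β : ℂ) (p : Fin n → ℂ) :
    Submodule (DStalk p) (DStalk (incl p)) where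
  carrier := {P | ∃ Q ∈ hypStalk a' β (incl p), ∃ R : DStalk (incl p), P = Q + coordD 0 * R}
  zero_mem' := ⟨0, Submodule.zero_mem _, 0, by simp⟩
  add_mem' := by
    rintro _ _ ⟨Q, hQ, R, rfl⟩ ⟨Q', hQ', R', rfl⟩
    exact ⟨Q + Q', Submodule.add_mem _ hQ hQ', R + R', by rw [mul_add]; abel⟩
  smul_mem' := by
    rintro P _ ⟨Q, hQ, R, rfl⟩
    refine ⟨liftD p P * Q, Submodule.smul_mem _ (liftD p P) hQ, liftD p P * R, ?_⟩
    rw [lift_smul_def, mul_add, ← mul_assoc, liftD_coordD, mul_assoc]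

/-- The stalk at `(0, p)` of `𝒟 / (𝒟 H_{a'}(β) + x₀ 𝒟)`, as a module over `𝒟_{ℂⁿ,p}`. -/
abbrev RestrMod {n : ℕ} (a' : Fin (n + 1) → ℤ) (β : ℂ) (p : Fin n → ℂ) : Type :=
  DStalk (incl p) ⧸ restrStalk a' β p

/-- The families of germs along the hyperplane that are classes of a section of the sheaf `𝒟` of
`ℂⁿ⁺¹` over a neighbourhood of the given part of the hyperplane. -/
def restrPrelocal {n : ℕ} (a' : Fin (n + 1) → ℤ) (β : ℂ) :
    TopCat.PrelocalPredicate fun x : X n => RestrMod a' β x where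
  pred {U} s := ∃ W : Opens (X (n + 1)), ∃ P ∈ DSections W, ∃ hW : ∀ x ∈ U, incl x ∈ W,
    ∀ x : U, s x = Submodule.Quotient.mk (P ⟨incl x.1, hW x.1 x.2⟩)
  res := by
    rintro U V i s ⟨W, P, hP, hW, hs⟩
    exact ⟨W, P, hP, fun x hx => hW x (i.le hx), fun x => hs _⟩

/-- A section of `𝒟` on `ℂⁿ` extends to one on `ℂⁿ⁺¹` not involving `x₀` and `∂₀`. -/
theorem exists_lift_section {n : ℕ} {U : Opens (X n)} {P : ∀ x : U, DStalk (x.1 : Fin n → ℂ)}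
    (hP : P ∈ basicSections U) (W : Opens (X (n + 1))) (hW : ∀ y ∈ W, Fin.tail y ∈ U) :
    ∃ P' ∈ DSections W, ∀ (x : U) (hx : incl x.1 ∈ W), P' ⟨incl x.1, hx⟩ = liftD x.1 (P x) := by
  suffices h : ∃ P' ∈ basicSections W, ∀ (x : U) (hx : incl x.1 ∈ W),
      P' ⟨incl x.1, hx⟩ = liftD x.1 (P x) by
    obtain ⟨P', hP', h⟩ := h
    exact ⟨P', basicSections_le W hP', h⟩
  induction hP using Algebra.adjoin_induction with
  | mem P hP =>
    obtain ⟨f, hf, rfl⟩ | ⟨i, rfl⟩ := hP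
    · exact ⟨mulSec W (pull f) fun y hy => analyticAt_pull (hf _ (hW y hy)),
        Algebra.subset_adjoin (Or.inl ⟨_, _, rfl⟩), fun x _ => (liftD_mulD (hf x.1 x.2)).symm⟩
    · exact ⟨fun _ => partialD i.succ, Algebra.subset_adjoin (Or.inr ⟨_, rfl⟩),
        fun x _ => (liftD_partialD i).symm⟩
  | algebraMap r =>
    exact ⟨_, (basicSections W).algebraMap_mem r, fun x _ => ((liftD x.1).commutes r).symm⟩
  | add P Q _ _ hP hQ =>
    obtain ⟨P', hP', h1⟩ := hP
    obtain ⟨Q', hQ', h2⟩ := hQ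
    refine ⟨_, (basicSections W).add_mem hP' hQ', fun x hx => ?_⟩
    rw [Pi.add_apply, Pi.add_apply, h1, h2, map_add]
  | mul P Q _ _ hP hQ =>
    obtain ⟨P', hP', h1⟩ := hP
    obtain ⟨Q', hQ', h2⟩ := hQ
    refine ⟨_, (basicSections W).mul_mem hP' hQ', fun x hx => ?_⟩
    rw [Pi.mul_apply, Pi.mul_apply, h1, h2, map_mul]

/-- The restriction `𝒟 / (𝒟 H_{a'}(β) + x₀ 𝒟)` of `ℳ_{a'}(β)` to the hyperplane `x₀ = 0` of `ℂⁿ⁺¹`,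
as a sheaf of left `𝒟`-modules on `ℂⁿ`. -/
def restrSheaf {n : ℕ} (a' : Fin (n + 1) → ℤ) (β : ℂ) : SheafOfModules (DSheaf n) :=
  modSheaf (fun x : X n => RestrMod a' β x) (restrPrelocal a' β)
    (fun U => ⟨⊤, 0, (DSections ⊤).zero_mem, fun _ _ => trivial, fun _ => rfl⟩)
    (by
      rintro U s t ⟨V, P, hP, hV, hs⟩ ⟨W, Q, hQ, hW, ht⟩
      exact ⟨V ⊓ W, _, (DSections (V ⊓ W)).add_mem
        (DSections_res inf_le_left hP) (DSections_res inf_le_right hQ),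
        fun x hx => ⟨hV x hx, hW x hx⟩, fun x => by
          rw [Pi.add_apply, hs, ht]
          rfl⟩)
    (by
      rintro U P s hP ⟨W, Q, hQ, hW, hs⟩
      let W' : Opens (X (n + 1)) := W ⊓ ⟨{y | Fin.tail y ∈ U},
        U.2.preimage (tailL n).continuous⟩
      obtain ⟨P', hP', h⟩ := exists_lift_section hP W' fun y hy => hy.2
      refine ⟨W', _, (DSections W').mul_mem hP'
        (DSections_res inf_le_left hQ),
        fun x hx => ⟨hW x hx, ?_⟩, fun x => ?_⟩
      · change Fin.tail (incl x) ∈ U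
        rwa [tail_incl]
      · change P x • s x = _
        rw [hs, Pi.mul_apply, h]
        rfl)
end HolD

end

/-!
For a left module `M` over the differential operators on `ℂⁿ`, an Euler family for `β` is a sequence
of `ψⱼ ∈ M` with `∂ᵢ ψⱼ = ψ_{j + aᵢ}` and `∑ aᵢ xᵢ ∂ᵢ ψⱼ = (β - j) ψⱼ`. The restriction of
`ℳ_{A'}(β)` is the module with a universal Euler family indexed by all of `ℕ`, namely the classes of
the powers `∂₀ʲ`: they are a basis of `𝒟_{X'} / x₀ 𝒟_{X'}` over `𝒟_X`, and the relations of
`H_{A'}(β)` become those of an Euler family. Likewise `ℳ_A(β)` has a universal Euler family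
indexed by the numerical semigroup `S` of the `aᵢ`: the monomials `∂ᵘ`, in degree `∑ aᵢ uᵢ`.

Since `(β - c) ψ_c = ∑ aᵢ xᵢ ψ_{c + aᵢ}`, an Euler family extends uniquely and downwards from
large indices across every index `c ≠ β`. Hence the two modules coincide if `β` is not one of the
finitely many gaps of `S`. Shifting the index of a family by `m` turns `β` into `β + m`; if
`β` is a gap, a shift by the conductor of `S` moves it past all the gaps.

The isomorphisms on stalks are compatible with sections, as the families consist of sections and
the sections of each sheaf are locally combinations of its family.
-/

noncomputable section

namespace HolD

/-! ### Euler families -/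

section OrderedMonomials

variable {S : Type*} [Monoid S] {n : ℕ}

/-- The ordered monomial `d₁^{u₁} ⋯ dₙ^{uₙ}` in elements of a monoid. -/
def ordPow (d : Fin n → S) (u : Fin n → ℕ) : S :=
  (List.ofFn fun i => d i ^ u i).prod

theorem ordPow_zero (d : Fin n → S) : ordPow d 0 = 1 := by
  simp [ordPow]

theorem ordPow_of_isEmpty (d : Fin 0 → S) (u : Fin 0 → ℕ) : ordPow d u = 1 := by
  simp [ordPow]

theorem ordPow_succ (d : Fin (n + 1) → S) (u : Fin (n + 1) → ℕ) :
    ordPow d u = d 0 ^ u 0 * ordPow (Fin.tail d) (Fin.tail u) := by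
  simp [ordPow, List.ofFn_succ, Fin.tail]

theorem map_ordPow {S' F : Type*} [Monoid S'] [FunLike F S S'] [MonoidHomClass F S S']
    (φ : F) (d : Fin n → S) (u : Fin n → ℕ) : φ (ordPow d u) = ordPow (φ ∘ d) u := by
  simp [ordPow, map_list_prod, List.map_ofFn, Function.comp_def]

theorem commute_ordPow {d : Fin n → S} {r : S} (h : ∀ i, Commute r (d i)) (u : Fin n → ℕ) :
    Commute r (ordPow d u) := by
  refine Commute.list_prod_right _ _ fun y hy => ?_
  obtain ⟨i, rfl⟩ := (List.mem_ofFn' _ _).1 hy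
  exact (h i).pow_right _

theorem ordPow_add {d : Fin n → S} (h : ∀ i j, Commute (d i) (d j)) (u v : Fin n → ℕ) :
    ordPow d (u + v) = ordPow d u * ordPow d v := by
  induction n with
  | zero => simp only [ordPow_of_isEmpty, one_mul]
  | succ n ih =>
    have swap : Commute (ordPow (Fin.tail d) (Fin.tail u)) (d 0 ^ v 0) :=
      ((commute_ordPow (fun i => h 0 i.succ) _).pow_left _).symm
    have tail_add : Fin.tail (u + v) = Fin.tail u + Fin.tail v := rfl
    rw [ordPow_succ, ordPow_succ d u, ordPow_succ d v, swap.mul_mul_mul_comm, ← pow_add,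
      tail_add, ih (d := Fin.tail d) fun i j => h i.succ j.succ, Pi.add_apply]

theorem ordPow_single (d : Fin n → S) (i : Fin n) (k : ℕ) :
    ordPow d (Pi.single i k) = d i ^ k := by
  induction n with
  | zero => exact i.elim0
  | succ n ih =>
    rw [ordPow_succ]
    cases i using Fin.cases with
    | zero =>
      have : Fin.tail (Pi.single 0 k : Fin (n + 1) → ℕ) = 0 := by ext; simp [Fin.tail]
      rw [this, ordPow_zero, Pi.single_eq_same, mul_one]
    | succ i =>
      have : Fin.tail (Pi.single i.succ k : Fin (n + 1) → ℕ) = Pi.single i k := by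
        ext; simp [Fin.tail, Pi.single_apply]
      rw [this, ih, Pi.single_eq_of_ne (Fin.succ_ne_zero i).symm, pow_zero, one_mul, Fin.tail]

theorem pow_smul_of_shift {M : Type*} [MulAction S M] {r : S} {c : ℕ} {T : Set ℕ} {ψ : ℕ → M}
    (hT : ∀ j ∈ T, j + c ∈ T) (h : ∀ j ∈ T, r • ψ j = ψ (j + c)) (k : ℕ) {j : ℕ} (hj : j ∈ T) :
    j + k * c ∈ T ∧ r ^ k • ψ j = ψ (j + k * c) := by
  induction k with
  | zero => simpa using hj
  | succ k ih =>
    rw [pow_succ', mul_smul, ih.2, h _ ih.1, Nat.succ_mul, ← add_assoc]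
    exact ⟨hT _ ih.1, rfl⟩

theorem ordPow_smul_of_shift {M : Type*} [MulAction S M] {d : Fin n → S} {a : Fin n → ℕ}
    {T : Set ℕ} {ψ : ℕ → M} (hT : ∀ j ∈ T, ∀ i, j + a i ∈ T)
    (h : ∀ j ∈ T, ∀ i, d i • ψ j = ψ (j + a i)) (u : Fin n → ℕ) {j : ℕ} (hj : j ∈ T) :
    j + u ⬝ᵥ a ∈ T ∧ ordPow d u • ψ j = ψ (j + u ⬝ᵥ a) := by
  induction n with
  | zero => simpa [ordPow_of_isEmpty] using hj
  | succ n ih =>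
    obtain ⟨tail_mem, tail_smul⟩ := ih (d := Fin.tail d) (a := Fin.tail a)
      (fun j hj i => hT j hj i.succ) (fun j hj i => h j hj i.succ) (Fin.tail u)
    have dot_succ : j + u ⬝ᵥ a = j + Fin.tail u ⬝ᵥ Fin.tail a + u 0 * a 0 := by
      rw [dotProduct, Fin.sum_univ_succ, add_comm (u 0 * a 0), ← add_assoc]
      rfl
    rw [ordPow_succ, mul_smul, tail_smul, dot_succ]
    exact pow_smul_of_shift (fun j hj => hT j hj 0) (fun j hj => h j hj 0) _ tail_mem

end OrderedMonomials

section EulerFamilies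

variable {ι K R M : Type*} [Field K] [Ring R] [Algebra K R] [AddCommGroup M]
  [Module R M] {x d : ι → R} {a : ι → ℕ} {β : K} {T : Set ℕ} {ψ φ : ℕ → M}

/-- The commutation relations between coordinates `x` and partial derivatives `d` that the theory
of Euler families uses. -/
structure WeylRelations [DecidableEq ι] (x d : ι → R) : Prop where
  commute : ∀ i j, Commute (d i) (d j)
  leibniz : ∀ i j, d i * x j = x j * d i + if i = j then 1 else 0

theorem WeylRelations.smul_pow_smul [DecidableEq ι] (hR : WeylRelations x d) {i : ι}
    {m : M} (hm : d i • m = 0) (j : ℕ) : d i • x i ^ j • m = j • x i ^ (j - 1) • m := by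
  induction j with
  | zero => simp [hm]
  | succ j ih =>
    rw [pow_succ', mul_smul, ← mul_smul (d i), hR.leibniz, if_pos rfl, add_smul, mul_smul, ih,
      one_smul, add_tsub_cancel_right, succ_nsmul]
    cases j with
    | zero => simp
    | succ j => rw [smul_comm, ← mul_smul (x i), add_tsub_cancel_right, ← pow_succ']

theorem WeylRelations.pow_smul_pow_smul [DecidableEq ι] (hR : WeylRelations x d) {i : ι}
    {m : M} (hm : d i • m = 0) (k j : ℕ) :
    d i ^ k • x i ^ j • m = j.descFactorial k • x i ^ (j - k) • m := by
  induction k with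
  | zero => simp
  | succ k ih =>
    rw [pow_succ', mul_smul, ih, smul_comm, hR.smul_pow_smul hm, ← mul_smul, mul_comm,
      ← Nat.descFactorial_succ, Nat.sub_sub]

variable [Fintype ι]

/-- The Euler operator `∑ aᵢ xᵢ ∂ᵢ` without its constant term. -/
def eulerSum (x d : ι → R) (a : ι → ℕ) : R := ∑ i, a i • (x i * d i)

theorem eulerSum_smul (m : M) : eulerSum x d a • m = ∑ i, a i • x i • d i • m := by
  simp only [eulerSum, Finset.sum_smul, smul_assoc, mul_smul]

theorem WeylRelations.mul_eulerSum [DecidableEq ι] (hR : WeylRelations x d) (i : ι) :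
    d i * eulerSum x d a = eulerSum x d a * d i + a i • d i := by
  have mul_term (k : ι) : d i * (a k • (x k * d k)) =
      a k • (x k * d k) * d i + if i = k then a k • d k else 0 := by
    rw [mul_smul_comm, ← mul_assoc, hR.leibniz, add_mul, mul_assoc, (hR.commute i k).eq,
      smul_add, ← mul_assoc, smul_mul_assoc, ite_mul, one_mul, zero_mul, smul_ite, smul_zero]
  rw [eulerSum, Finset.mul_sum, Finset.sum_congr rfl fun k _ => mul_term k,
    Finset.sum_add_distrib, ← Finset.sum_mul, Finset.sum_ite_eq, if_pos (Finset.mem_univ i)]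

theorem WeylRelations.pow_mul_eulerSum [DecidableEq ι] (hR : WeylRelations x d) (i : ι) (k : ℕ) :
    d i ^ k * eulerSum x d a = eulerSum x d a * d i ^ k + (k * a i) • d i ^ k := by
  induction k with
  | zero => simp
  | succ k ih =>
    rw [pow_succ', mul_assoc, ih, mul_add, ← mul_assoc, hR.mul_eulerSum, add_mul, mul_assoc,
      smul_mul_assoc, mul_smul_comm, add_assoc, ← add_smul, Nat.succ_mul, add_comm (k * a i)]

/-- A family `(ψⱼ)` of vectors that behaves for `j ∈ T` like `ψⱼ = ∂ᵘ ψ₀`, `j = ∑ aᵢ uᵢ`, where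
`ψ₀` is killed by the Euler operator `∑ aᵢ xᵢ ∂ᵢ - β`. The values outside `T` are irrelevant. -/
structure IsEulerFamily (x d : ι → R) (a : ι → ℕ) (β : K) (T : Set ℕ) (ψ : ℕ → M) : Prop where
  add_mem : ∀ j ∈ T, ∀ i, j + a i ∈ T
  partial_smul : ∀ j ∈ T, ∀ i, d i • ψ j = ψ (j + a i)
  euler_smul : ∀ j ∈ T, eulerSum x d a • ψ j = algebraMap K R (β - j) • ψ j

namespace IsEulerFamily

theorem sum_smul_add (h : IsEulerFamily x d a β T ψ) {j : ℕ} (hj : j ∈ T) :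
    ∑ i, a i • x i • ψ (j + a i) = algebraMap K R (β - j) • ψ j := by
  simp only [← h.euler_smul j hj, eulerSum_smul, h.partial_smul j hj]

theorem map {M' : Type*} [AddCommGroup M'] [Module R M'] (f : M →ₗ[R] M')
    (h : IsEulerFamily x d a β T ψ) : IsEulerFamily x d a β T (f ∘ ψ) where
  add_mem := h.add_mem
  partial_smul j hj i := by
    rw [Function.comp_apply, ← map_smul, h.partial_smul j hj, Function.comp_apply]
  euler_smul j hj := by rw [Function.comp_apply, ← map_smul, h.euler_smul j hj, map_smul]

theorem mono {T' : Set ℕ} (h : IsEulerFamily x d a β T ψ) (hsub : T' ⊆ T)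
    (hT' : ∀ j ∈ T', ∀ i, j + a i ∈ T') : IsEulerFamily x d a β T' ψ where
  add_mem := hT'
  partial_smul j hj := h.partial_smul j (hsub hj)
  euler_smul j hj := h.euler_smul j (hsub hj)

theorem ordPow_smul {n : ℕ} {x d : Fin n → R} {a : Fin n → ℕ} (h : IsEulerFamily x d a β T ψ)
    (u : Fin n → ℕ) {j : ℕ} (hj : j ∈ T) : ordPow d u • ψ j = ψ (j + u ⬝ᵥ a) :=
  (ordPow_smul_of_shift h.add_mem h.partial_smul u hj).2

/-- It is enough to check the Euler relation at `0`: the commutator of `∂ᵢ` with the Euler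
operator is `aᵢ ∂ᵢ`. -/
theorem of_closure [DecidableEq ι] (hR : WeylRelations x d)
    (hψ : ∀ j ∈ AddSubmonoid.closure (Set.range a), ∀ i, d i • ψ j = ψ (j + a i))
    (h0 : eulerSum x d a • ψ 0 = algebraMap K R β • ψ 0) :
    IsEulerFamily x d a β (AddSubmonoid.closure (Set.range a) : Set ℕ) ψ where
  add_mem _ hj i := AddSubmonoid.add_mem _ hj (AddSubmonoid.subset_closure (Set.mem_range_self i))
  partial_smul := hψ
  euler_smul j hj := by
    induction hj using AddSubmonoid.closure_induction_right with
    | zero => rwa [Nat.cast_zero, sub_zero]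
    | add_right j hj _ hi ih =>
      obtain ⟨i, rfl⟩ := hi
      have commutator := congrArg (· • ψ j) (hR.mul_eulerSum (a := a) i)
      simp only [mul_smul, add_smul, smul_assoc, ih, hψ j hj i] at commutator
      rw [← mul_smul, ← Algebra.commutes, mul_smul, hψ j hj i, ← sub_eq_iff_eq_add] at commutator
      rw [← commutator, Nat.cast_add, ← sub_sub, map_sub _ (β - j), map_natCast, sub_smul,
        Nat.cast_smul_eq_nsmul]

theorem shift_right (h : IsEulerFamily x d a β Set.univ ψ) (m : ℕ) :
    IsEulerFamily x d a (β + m) (Set.Ici m) fun j => ψ (j - m) where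
  add_mem _ hj i := Nat.le_add_right_of_le hj
  partial_smul j hj i := by rw [h.partial_smul _ trivial, ← Nat.sub_add_comm hj]
  euler_smul j hj := by rw [h.euler_smul _ trivial, Nat.cast_sub hj, sub_sub_eq_add_sub]

theorem shift_left {m : ℕ} (h : IsEulerFamily x d a (β + m) Set.univ ψ) :
    IsEulerFamily x d a β Set.univ fun j => ψ (j + m) where
  add_mem _ _ _ := trivial
  partial_smul j _ i := by rw [h.partial_smul _ trivial, add_right_comm]
  euler_smul j _ := by rw [h.euler_smul _ trivial, Nat.cast_add, add_sub_add_right_eq_sub]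

theorem eq_inv_smul_sum (h : IsEulerFamily x d a β T ψ) {j : ℕ} (hj : j ∈ T) (hβ : β ≠ j) :
    ψ j = algebraMap K R (β - j)⁻¹ • ∑ i, a i • x i • ψ (j + a i) := by
  rw [h.sum_smul_add hj, ← mul_smul, ← map_mul, inv_mul_cancel₀ (sub_ne_zero.2 hβ), map_one,
    one_smul]

theorem forall_mem (h : IsEulerFamily x d a β Set.univ ψ) (ha : ∀ i, 0 < a i)
    (hT : ∀ᶠ j in atTop, j ∈ T) (hβ : ∀ j ∉ T, β ≠ (j : ℕ)) (N : Submodule R M)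
    (hN : ∀ j ∈ T, ψ j ∈ N) (j : ℕ) : ψ j ∈ N := by
  obtain ⟨c, hc⟩ := eventually_atTop.1 hT
  refine Nat.strong_decreasing_induction (P := fun j => ψ j ∈ N)
    ⟨c, fun j hj => hN j (hc j hj.le)⟩ (fun j ih => ?_) j
  by_cases hj : j ∈ T
  · exact hN j hj
  · rw [h.eq_inv_smul_sum trivial (hβ j hj)]
    exact N.smul_mem _ (N.sum_mem fun i _ => N.smul_of_tower_mem _
      (N.smul_mem _ (ih _ (Nat.lt_add_of_pos_right (ha i)))))

theorem eq_of_eqOn (hψ : IsEulerFamily x d a β Set.univ ψ) (hφ : IsEulerFamily x d a β Set.univ φ)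
    (ha : ∀ i, 0 < a i) (hT : ∀ᶠ j in atTop, j ∈ T) (hβ : ∀ j ∉ T, β ≠ (j : ℕ))
    (heq : Set.EqOn ψ φ T) : ψ = φ := by
  obtain ⟨c, hc⟩ := eventually_atTop.1 hT
  refine funext <| Nat.strong_decreasing_induction (P := fun j => ψ j = φ j)
    ⟨c, fun j hj => heq (hc j hj.le)⟩ fun j ih => ?_
  by_cases hj : j ∈ T
  · exact heq hj
  · rw [hψ.eq_inv_smul_sum trivial (hβ j hj), hφ.eq_inv_smul_sum trivial (hβ j hj)]
    simp only [ih _ (Nat.lt_add_of_pos_right (ha _))]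

theorem partial_smul_sum [DecidableEq ι] (hR : WeylRelations x d) (h : IsEulerFamily x d a β T ψ)
    {c : ℕ} (hc : ∀ i, c + a i ∈ T) (i : ι) :
    d i • ∑ k, a k • x k • ψ (c + a k) = algebraMap K R (β - c) • ψ (c + a i) := by
  have smul_term (k : ι) : d i • a k • x k • ψ (c + a k) =
      a k • x k • ψ (c + a i + a k) + if i = k then a k • ψ (c + a k) else 0 := by
    rw [smul_comm, ← mul_smul, hR.leibniz, add_smul, mul_smul, h.partial_smul _ (hc k),
      add_right_comm c, smul_add, ite_smul, one_smul, zero_smul, smul_ite, smul_zero]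
  rw [Finset.smul_sum, Finset.sum_congr rfl fun k _ => smul_term k, Finset.sum_add_distrib,
    h.sum_smul_add (hc i), Finset.sum_ite_eq, if_pos (Finset.mem_univ i), Nat.cast_add,
    ← sub_sub, map_sub _ (β - c), map_natCast, sub_smul, Nat.cast_smul_eq_nsmul, sub_add_cancel]

theorem insert (h : IsEulerFamily x d a β T ψ) {c : ℕ} {v : M} (hcT : c ∉ T)
    (hc : ∀ i, c + a i ∈ T) (hd : ∀ i, d i • v = ψ (c + a i))
    (hE : eulerSum x d a • v = algebraMap K R (β - c) • v) :
    IsEulerFamily x d a β (insert c T) (Function.update ψ c v) := by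
  have update_of_mem {j : ℕ} (hj : j ∈ T) : Function.update ψ c v j = ψ j :=
    Function.update_of_ne (ne_of_mem_of_not_mem hj hcT) _ _
  refine ⟨?_, ?_, ?_⟩ <;> rintro j (rfl | hj)
  · exact fun i => Or.inr (hc i)
  · exact fun i => Or.inr (h.add_mem j hj i)
  · intro i
    rw [Function.update_self, update_of_mem (hc i), hd]
  · intro i
    rw [update_of_mem hj, update_of_mem (h.add_mem j hj i), h.partial_smul j hj]
  · rw [Function.update_self, hE]
  · rw [update_of_mem hj, h.euler_smul j hj]

theorem exists_insert [DecidableEq ι] (hR : WeylRelations x d) (h : IsEulerFamily x d a β T ψ)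
    {c : ℕ} (hcT : c ∉ T) (hc : ∀ i, c + a i ∈ T) (hβ : β ≠ c) :
    ∃ v, IsEulerFamily x d a β (Insert.insert c T) (Function.update ψ c v) := by
  have hβ' : β - c ≠ 0 := sub_ne_zero.2 hβ
  let v : M := algebraMap K R (β - c)⁻¹ • ∑ i, a i • x i • ψ (c + a i)
  have partial_smul_v (i : ι) : d i • v = ψ (c + a i) := by
    rw [← mul_smul, ← Algebra.commutes, mul_smul, h.partial_smul_sum hR hc, ← mul_smul, ← map_mul,
      inv_mul_cancel₀ hβ', map_one, one_smul]
  refine ⟨v, h.insert hcT hc partial_smul_v ?_⟩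
  rw [← mul_smul (algebraMap K R _), ← map_mul, mul_inv_cancel₀ hβ', map_one, one_smul,
    eulerSum_smul]
  simp only [partial_smul_v]

theorem exists_extension [DecidableEq ι] (hR : WeylRelations x d)
    (h : IsEulerFamily x d a β T ψ) (ha : ∀ i, 0 < a i) (hT : ∀ᶠ j in atTop, j ∈ T)
    (hβ : ∀ j ∉ T, β ≠ (j : ℕ)) :
    ∃ φ : ℕ → M, IsEulerFamily x d a β Set.univ φ ∧ Set.EqOn φ ψ T := by
  obtain ⟨c, hc⟩ := eventually_atTop.1 hT
  clear hT
  induction c generalizing T ψ with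
  | zero =>
    obtain rfl : T = Set.univ := Set.eq_univ_of_forall fun j => hc j (Nat.zero_le j)
    exact ⟨ψ, h, fun _ _ => rfl⟩
  | succ c ih =>
    by_cases hcT : c ∈ T
    · exact ih h hβ fun j hj => hj.eq_or_lt.elim (fun e => e ▸ hcT) (hc j)
    · obtain ⟨v, hv⟩ := h.exists_insert hR hcT
        (fun i => hc _ (Nat.add_lt_add_left (ha i) c)) (hβ c hcT)
      obtain ⟨φ, hφ, hφv⟩ := ih hv (fun j hj => hβ j fun hjT => hj (Or.inr hjT))
        fun j hj => hj.eq_or_lt.imp Eq.symm (hc j)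
      refine ⟨φ, hφ, fun j hj => ?_⟩
      rw [hφv (Or.inr hj), Function.update_of_ne (ne_of_mem_of_not_mem hj hcT)]

end IsEulerFamily

universe v

/-- An Euler family on `T` generating its module and mapping to every other Euler family on `T`. -/
structure IsUniversalEulerFamily {M : Type v} [AddCommGroup M] [Module R M] (x d : ι → R)
    (a : ι → ℕ) (β : K) (T : Set ℕ) (ψ : ℕ → M) : Prop extends IsEulerFamily x d a β T ψ where
  span_eq_top : Submodule.span R (ψ '' T) = ⊤
  exists_lift : ∀ {N : Type v} [AddCommGroup N] [Module R N] {φ : ℕ → N},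
    IsEulerFamily x d a β T φ → ∃ f : M →ₗ[R] N, ∀ j ∈ T, f (ψ j) = φ j

namespace IsUniversalEulerFamily

variable {M N : Type v} [AddCommGroup M] [Module R M] [AddCommGroup N] [Module R N] {ψ : ℕ → M}

theorem hom_ext (h : IsUniversalEulerFamily x d a β T ψ) {f g : M →ₗ[R] N}
    (hfg : ∀ j ∈ T, f (ψ j) = g (ψ j)) : f = g :=
  LinearMap.ext_on h.span_eq_top (Set.forall_mem_image.2 hfg)

theorem exists_linearEquiv {φ : ℕ → N} (hψ : IsUniversalEulerFamily x d a β T ψ)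
    (hφ : IsUniversalEulerFamily x d a β T φ) : ∃ e : M ≃ₗ[R] N, ∀ j ∈ T, e (ψ j) = φ j := by
  obtain ⟨f, hf⟩ := hψ.exists_lift hφ.toIsEulerFamily
  obtain ⟨g, hg⟩ := hφ.exists_lift hψ.toIsEulerFamily
  exact ⟨.ofLinearMap f g
    (hφ.hom_ext fun j hj => by rw [LinearMap.comp_apply, hg j hj, hf j hj, LinearMap.id_apply])
    (hψ.hom_ext fun j hj => by rw [LinearMap.comp_apply, hf j hj, hg j hj, LinearMap.id_apply]), hf⟩

theorem exists_extension [DecidableEq ι] (hR : WeylRelations x d)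
    (h : IsUniversalEulerFamily x d a β T ψ) (ha : ∀ i, 0 < a i) (hT : ∀ᶠ j in atTop, j ∈ T)
    (hβ : ∀ j ∉ T, β ≠ (j : ℕ)) :
    ∃ φ : ℕ → M, IsUniversalEulerFamily x d a β Set.univ φ ∧ Set.EqOn φ ψ T := by
  obtain ⟨φ, hφ, hφψ⟩ := h.toIsEulerFamily.exists_extension hR ha hT hβ
  refine ⟨φ, ⟨hφ, ?_, fun {N} _ _ φ' hφ' => ?_⟩, hφψ⟩
  · rw [eq_top_iff, ← h.span_eq_top, ← hφψ.image_eq]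
    exact Submodule.span_mono (Set.image_mono (Set.subset_univ T))
  · obtain ⟨f, hf⟩ := h.exists_lift (hφ'.mono (Set.subset_univ T) h.add_mem)
    refine ⟨f, fun j _ => congrFun ((hφ.map f).eq_of_eqOn hφ' ha hT hβ fun j hj => ?_) j⟩
    rw [Function.comp_apply, hφψ hj, hf j hj]

theorem exists_shift [DecidableEq ι] (hR : WeylRelations x d)
    (h : IsUniversalEulerFamily x d a β Set.univ ψ) (ha : ∀ i, 0 < a i) {m : ℕ}
    (hβ : ∀ j < m, β + m ≠ (j : ℕ)) :
    ∃ φ : ℕ → M, IsUniversalEulerFamily x d a (β + m) Set.univ φ ∧ ∀ j, φ (j + m) = ψ j := by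
  have hT : ∀ᶠ j in atTop, j ∈ Set.Ici m := eventually_ge_atTop m
  have hβ' : ∀ j ∉ Set.Ici m, β + m ≠ (j : ℕ) := fun j hj => hβ j (not_le.1 hj)
  obtain ⟨φ, hφ, hφψ⟩ := (h.toIsEulerFamily.shift_right m).exists_extension hR ha hT hβ'
  have apply_add (j : ℕ) : φ (j + m) = ψ j := by
    simp only [hφψ (Nat.le_add_left m j), Nat.add_sub_cancel]
  refine ⟨φ, ⟨hφ, ?_, fun {N} _ _ φ' hφ' => ?_⟩, apply_add⟩
  · rw [eq_top_iff, ← h.span_eq_top]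
    refine Submodule.span_mono ?_
    rintro _ ⟨j, -, rfl⟩
    exact ⟨j + m, trivial, apply_add j⟩
  · obtain ⟨f, hf⟩ := h.exists_lift hφ'.shift_left
    refine ⟨f, fun j _ => congrFun ((hφ.map f).eq_of_eqOn hφ' ha hT hβ' fun j hj => ?_) j⟩
    rw [Function.comp_apply, hφψ hj, hf _ trivial, Nat.sub_add_cancel hj]

end IsUniversalEulerFamily

end EulerFamilies

/-! ### Division by `x₀` -/

section Averages

variable {E : Type*} [NormedAddCommGroup E] [NormedSpace ℂ E] {L : ℝ → E →L[ℂ] E}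

/-- The power series of `y ↦ ∫₀¹ F (L t y) dt`, where `P` is the power series of `F`. -/
def averagedSeries (P : FormalMultilinearSeries ℂ E ℂ) (L : ℝ → E →L[ℂ] E) :
    FormalMultilinearSeries ℂ E ℂ :=
  fun m => ∫ t in (0 : ℝ)..1, (P m).compContinuousLinearMap fun _ => L t

theorem norm_averagedSeries_le (P : FormalMultilinearSeries ℂ E ℂ)
    (hL1 : ∀ t ∈ Set.uIoc (0 : ℝ) 1, ‖L t‖ ≤ 1) (m : ℕ) : ‖averagedSeries P L m‖ ≤ ‖P m‖ := by
  have norm_comp_le : ∀ t ∈ Set.uIoc (0 : ℝ) 1,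
      ‖(P m).compContinuousLinearMap fun _ => L t‖ ≤ ‖P m‖ := fun t ht =>
    ((P m).norm_compContinuousLinearMap_le _).trans (mul_le_of_le_one_right (norm_nonneg _)
      (Finset.prod_le_one (fun _ _ => norm_nonneg _) fun _ _ => hL1 t ht))
  simpa [averagedSeries] using intervalIntegral.norm_integral_le_of_norm_le_const norm_comp_le

theorem radius_le_radius_averagedSeries (P : FormalMultilinearSeries ℂ E ℂ)
    (hL1 : ∀ t ∈ Set.uIoc (0 : ℝ) 1, ‖L t‖ ≤ 1) : P.radius ≤ (averagedSeries P L).radius := by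
  refine ENNReal.le_of_forall_nnreal_lt fun r hr => ?_
  obtain ⟨C, -, hC⟩ := P.norm_mul_pow_le_of_lt_radius hr
  exact (averagedSeries P L).le_radius_of_bound C fun m =>
    (mul_le_mul_of_nonneg_right (norm_averagedSeries_le P hL1 m) (by positivity)).trans (hC m)

theorem averagedSeries_apply (P : FormalMultilinearSeries ℂ E ℂ) (hL : Continuous L) (m : ℕ)
    (y : E) : (averagedSeries P L m fun _ => y) = ∫ t in (0 : ℝ)..1, P m fun _ => L t y := by
  have hcont : Continuous fun t => (P m).compContinuousLinearMap fun _ => L t :=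
    ((P m).compContinuousLinearMapLRight (E := fun _ : Fin m => E)).cont.comp
      (continuous_pi fun _ => hL)
  exact ((ContinuousMultilinearMap.apply ℂ (fun _ : Fin m => E) ℂ fun _ => y)
    |>.intervalIntegral_comp_comm (hcont.intervalIntegrable 0 1)).symm

theorem hasFPowerSeriesOnBall_integral_contraction {F : E → ℂ} {q : E}
    {P : FormalMultilinearSeries ℂ E ℂ} {r : ENNReal} (hP : HasFPowerSeriesOnBall F P q r)
    (hL : Continuous L) (hL1 : ∀ t ∈ Set.uIoc (0 : ℝ) 1, ‖L t‖ ≤ 1) :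
    HasFPowerSeriesOnBall (fun y => ∫ t in (0 : ℝ)..1, F (q + L t (y - q)))
      (averagedSeries P L) q r := by
  refine ⟨hP.r_le.trans (radius_le_radius_averagedSeries P hL1), hP.r_pos, fun {y} hy => ?_⟩
  have norm_apply_le : ∀ t ∈ Set.uIoc (0 : ℝ) 1, ‖L t y‖ ≤ ‖y‖ := fun t ht =>
    ((L t).le_opNorm y).trans (mul_le_of_le_one_left (norm_nonneg _) (hL1 t ht))
  have hyr : (‖y‖₊ : ENNReal) < r := mem_eball_zero_iff.1 hy
  simp only [averagedSeries_apply P hL, add_sub_cancel_left]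
  refine intervalIntegral.hasSum_integral_of_dominated_convergence
    (fun m _ => ‖P m‖ * (‖y‖₊ : ℝ) ^ m) (fun m => ?_) (fun m => .of_forall fun t ht => ?_)
    (.of_forall fun t _ => P.summable_norm_mul_pow (hyr.trans_le hP.r_le))
    intervalIntegrable_const (.of_forall fun t ht => hP.hasSum ?_)
  · exact ((P m).cont.comp
      (continuous_pi fun _ => hL.clm_apply continuous_const)).aestronglyMeasurable
  · refine ((P m).le_opNorm _).trans (mul_le_mul_of_nonneg_left ?_ (norm_nonneg _))
    simpa using pow_le_pow_left₀ (norm_nonneg _) (norm_apply_le t ht) m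
  · exact mem_eball_zero_iff.2 ((ENNReal.coe_le_coe.2 (norm_apply_le t ht)).trans_lt hyr)

end Averages

section Division

variable {n : ℕ}

/-- The linear map `(x₀, x₁, …, xₙ) ↦ (t x₀, x₁, …, xₙ)`. -/
def scaleFirst (n : ℕ) (t : ℝ) : (Fin (n + 1) → ℂ) →L[ℂ] (Fin (n + 1) → ℂ) :=
  (inclL n).comp (tailL n) + (t : ℂ) •
    (ContinuousLinearMap.proj (R := ℂ) (φ := fun _ : Fin (n + 1) => ℂ) 0).smulRight (Pi.single 0 1)

theorem continuous_scaleFirst : Continuous (scaleFirst n) := by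
  unfold scaleFirst
  fun_prop

theorem scaleFirst_apply (t : ℝ) (y : Fin (n + 1) → ℂ) :
    scaleFirst n t y = Fin.cons (t * y 0) (Fin.tail y) := by
  ext j
  cases j using Fin.cases <;> simp [scaleFirst, inclL, tailL, Fin.tail]

theorem scaleFirst_incl (t : ℝ) (p : Fin n → ℂ) : scaleFirst n t (incl p) = incl p := by
  simp [scaleFirst_apply, incl]

theorem norm_scaleFirst_le {t : ℝ} (ht : t ∈ Set.Icc (0 : ℝ) 1) : ‖scaleFirst n t‖ ≤ 1 := by
  refine ContinuousLinearMap.opNorm_le_bound _ zero_le_one fun y => ?_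
  rw [one_mul, pi_norm_le_iff_of_nonneg (norm_nonneg _), scaleFirst_apply]
  intro j
  cases j using Fin.cases with
  | zero =>
    rw [Fin.cons_zero, norm_mul, Complex.norm_real, Real.norm_eq_abs, abs_of_nonneg ht.1]
    exact (mul_le_of_le_one_left (norm_nonneg _) ht.2).trans (norm_le_pi_norm y 0)
  | succ j => exact norm_le_pi_norm y j.succ

theorem scaleFirst_mem_ball {p : Fin n → ℂ} {r : ℝ} {t : ℝ} (ht : t ∈ Set.Icc (0 : ℝ) 1)
    {y : Fin (n + 1) → ℂ} (hy : y ∈ Metric.ball (incl p) r) :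
    scaleFirst n t y ∈ Metric.ball (incl p) r := by
  rw [mem_ball_iff_norm] at hy ⊢
  rw [← scaleFirst_incl t p, ← map_sub]
  exact (((scaleFirst n t).le_opNorm _).trans
    (mul_le_of_le_one_left (norm_nonneg _) (norm_scaleFirst_le ht))).trans_lt hy

theorem hasDerivAt_scaleFirst (y : Fin (n + 1) → ℂ) (t : ℝ) :
    HasDerivAt (fun t => scaleFirst n t y) (y 0 • Pi.single 0 1) t := by
  rw [hasDerivAt_pi]
  intro j
  simp only [scaleFirst_apply]
  cases j using Fin.cases with
  | zero => simpa using Complex.ofRealCLM.hasDerivAt.mul_const (y 0)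
  | succ j => simpa using hasDerivAt_const t (Fin.tail y j)

theorem sub_eq_mul_integral_pderiv {p : Fin n → ℂ} {r : ℝ} {g : (Fin (n + 1) → ℂ) → ℂ}
    (hg : AnalyticOnNhd ℂ g (Metric.ball (incl p) r)) {y : Fin (n + 1) → ℂ}
    (hy : y ∈ Metric.ball (incl p) r) :
    g y - pull (g ∘ incl) y = y 0 * ∫ t in (0 : ℝ)..1, pderiv 0 g (scaleFirst n t y) := by
  have analyticAt_scale : ∀ t ∈ Set.uIcc (0 : ℝ) 1, AnalyticAt ℂ g (scaleFirst n t y) :=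
    fun t ht => hg _ (scaleFirst_mem_ball (Set.uIcc_of_le (zero_le_one' ℝ) ▸ ht) hy)
  have hasDerivAt_comp : ∀ t ∈ Set.uIcc (0 : ℝ) 1, HasDerivAt (fun t : ℝ => g (scaleFirst n t y))
      (y 0 * pderiv 0 g (scaleFirst n t y)) t := fun t ht => by
    simpa [pderiv, Function.comp_def] using
      ((analyticAt_scale t ht).differentiableAt.hasFDerivAt.restrictScalars ℝ).comp_hasDerivAt t
        (hasDerivAt_scaleFirst y t)
  have integrable : IntervalIntegrable (fun t : ℝ => y 0 * pderiv 0 g (scaleFirst n t y))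
      MeasureTheory.volume 0 1 :=
    ContinuousOn.intervalIntegrable fun t ht => ContinuousAt.continuousWithinAt <|
      continuousAt_const.mul <| ContinuousAt.comp (g := pderiv 0 g)
        (analyticAt_pderiv 0 (analyticAt_scale t ht)).continuousAt
        (hasDerivAt_scaleFirst y t).continuousAt
  have scale_one : scaleFirst n 1 y = y := by simp [scaleFirst_apply]
  have scale_zero : scaleFirst n 0 y = incl (Fin.tail y) := by simp [scaleFirst_apply, incl]
  rw [← intervalIntegral.integral_const_mul,
    intervalIntegral.integral_eq_sub_of_hasDerivAt hasDerivAt_comp integrable, scale_one,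
    scale_zero]
  rfl

/-- The quotient `(g - g|_{x₀ = 0}) / x₀` is holomorphic because it is the average of `∂₀ g` over
the segment from `(0, x₁, …, xₙ)` to `(x₀, x₁, …, xₙ)`. -/
theorem exists_eq_pull_add_coord_mul {p : Fin n → ℂ} {g : (Fin (n + 1) → ℂ) → ℂ}
    (hg : AnalyticAt ℂ g (incl p)) :
    ∃ h, AnalyticAt ℂ h (incl p) ∧
      g =ᶠ[𝓝 (incl p)] fun y => pull (g ∘ incl) y + y 0 * h y := by
  obtain ⟨r, hr, hB⟩ := Metric.eventually_nhds_iff_ball.1 hg.eventually_analyticAt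
  obtain ⟨P, s, hP⟩ := analyticAt_pderiv 0 hg
  have analytic_average := (hasFPowerSeriesOnBall_integral_contraction hP continuous_scaleFirst
    fun t ht => norm_scaleFirst_le
      (Set.uIcc_of_le (zero_le_one' ℝ) ▸ Set.uIoc_subset_uIcc ht)).analyticAt
  refine ⟨_, analytic_average, ?_⟩
  filter_upwards [Metric.ball_mem_nhds _ hr] with y hy
  simp only [map_sub, scaleFirst_incl, add_sub_cancel]
  rw [← sub_eq_mul_integral_pderiv hB hy, add_sub_cancel]

end Division

/-! ### Relations in the ring of differential operators -/

section Relations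

variable {n : ℕ} {p : Fin n → ℂ} {f g : (Fin n → ℂ) → ℂ}

theorem mulD_congr (hf : AnalyticAt ℂ f p) (hg : AnalyticAt ℂ g p) (h : f =ᶠ[𝓝 p] g) :
    mulD f hf = mulD g hg :=
  Subtype.ext <| LinearMap.ext fun φ => Subtype.ext <| congrArg (· * φ.1) (Germ.coe_eq.2 h)

theorem mulD_add (hf : AnalyticAt ℂ f p) (hg : AnalyticAt ℂ g p) :
    mulD (fun y => f y + g y) (hf.add hg) = mulD f hf + mulD g hg :=
  Subtype.ext <| LinearMap.ext fun φ => Subtype.ext <| add_mul (f : Germ (𝓝 p) ℂ) g φ.1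

theorem mulD_mul (hf : AnalyticAt ℂ f p) (hg : AnalyticAt ℂ g p) :
    mulD (fun y => f y * g y) (hf.mul hg) = mulD f hf * mulD g hg :=
  Subtype.ext <| LinearMap.ext fun φ => Subtype.ext <| mul_assoc (f : Germ (𝓝 p) ℂ) g φ.1

theorem mulD_const (c : ℂ) :
    mulD (fun _ => c) (analyticAt_const (x := p)) = algebraMap ℂ (DStalk p) c := by
  refine Subtype.ext (LinearMap.ext fun φ => ?_)
  cases φ using HolGerm.ind
  rfl

theorem partialD_mul_mulD (i : Fin n) (hf : AnalyticAt ℂ f p) :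
    partialD i * mulD f hf =
      mulD f hf * partialD i + mulD (pderiv i f) (analyticAt_pderiv i hf) := by
  refine Subtype.ext (LinearMap.ext fun g => ?_)
  induction g using HolGerm.ind with
  | h g hg =>
    refine holGerm_eq_iff (hf := analyticAt_pderiv i (hf.mul hg))
      (hg := (hf.mul (analyticAt_pderiv i hg)).add ((analyticAt_pderiv i hf).mul hg)).2 ?_
    filter_upwards [hf.eventually_analyticAt, hg.eventually_analyticAt] with x hfx hgx
    simp [pderiv, fderiv_mul hfx.differentiableAt hgx.differentiableAt, mul_comm]

theorem commute_partialD (i j : Fin n) : Commute (partialD i : DStalk p) (partialD j) :=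
  Subtype.ext (partialOp_comm i j)

theorem pderiv_coord (i j : Fin n) :
    pderiv i (fun x => x j) = fun _ => if i = j then (1 : ℂ) else 0 := by
  ext x
  have fderiv_coord : fderiv ℂ (fun x : Fin n → ℂ => x j) x = ContinuousLinearMap.proj j :=
    (ContinuousLinearMap.proj (R := ℂ) (φ := fun _ : Fin n => ℂ) j).fderiv
  simp [pderiv, fderiv_coord, Pi.single_apply, eq_comm]

theorem weylRelations_DStalk (p : Fin n → ℂ) :
    WeylRelations (fun i => (coordD i : DStalk p)) partialD where
  commute := commute_partialD
  leibniz i j := by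
    refine (partialD_mul_mulD i (analyticAt_coord j p)).trans
      (congrArg (coordD j * partialD i + ·) ?_)
    rw [mulD_congr _ (analyticAt_const (v := if i = j then (1 : ℂ) else 0))
      (by rw [pderiv_coord]), mulD_const]
    split_ifs <;> simp

/-- `xᵢ` as a section of `𝒟`. -/
def coordSec (U : Opens (X n)) (i : Fin n) : DSections U :=
  ⟨fun _ => coordD i, basicSections_le U (Algebra.subset_adjoin
    (Or.inl ⟨fun x => x i, fun x _ => analyticAt_coord i x, rfl⟩))⟩

/-- `∂ᵢ` as a section of `𝒟`. -/
def partialSec (U : Opens (X n)) (i : Fin n) : DSections U :=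
  ⟨fun _ => partialD i, basicSections_le U (Algebra.subset_adjoin (Or.inr ⟨i, rfl⟩))⟩

theorem exists_basicSection_apply_eq (P : DStalk p) :
    ∃ (U : Opens (X n)) (hp : p ∈ U), ∃ s ∈ basicSections U, s ⟨p, hp⟩ = P := by
  obtain ⟨T, hT⟩ := P
  induction hT using Algebra.adjoin_induction with
  | mem T hT =>
    obtain ⟨f, hf, rfl⟩ | ⟨i, rfl⟩ := hT
    · obtain ⟨V, hV, hVo, hpV⟩ := eventually_nhds_iff.1 hf.eventually_analyticAt
      exact ⟨⟨V, hVo⟩, hpV, mulSec _ f hV, Algebra.subset_adjoin (Or.inl ⟨f, hV, rfl⟩), rfl⟩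
    · exact ⟨⊤, trivial, _, Algebra.subset_adjoin (Or.inr ⟨i, rfl⟩), rfl⟩
  | algebraMap r => exact ⟨⊤, trivial, _, (basicSections ⊤).algebraMap_mem r, rfl⟩
  | add S T hS hT ihS ihT =>
    obtain ⟨U, hpU, s, hs, hsS⟩ := ihS
    obtain ⟨V, hpV, t, ht, htT⟩ := ihT
    exact ⟨U ⊓ V, ⟨hpU, hpV⟩, _, (basicSections _).add_mem
      (basicSections_res (Opens.infLELeft U V) hs) (basicSections_res (Opens.infLERight U V) ht),
      congrArg₂ (· + ·) hsS htT⟩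
  | mul S T hS hT ihS ihT =>
    obtain ⟨U, hpU, s, hs, hsS⟩ := ihS
    obtain ⟨V, hpV, t, ht, htT⟩ := ihT
    exact ⟨U ⊓ V, ⟨hpU, hpV⟩, _, (basicSections _).mul_mem
      (basicSections_res (Opens.infLELeft U V) hs) (basicSections_res (Opens.infLERight U V) ht),
      congrArg₂ (· * ·) hsS htT⟩

end Relations

/-! ### Differential operators modulo `x₀ 𝒟` -/

section FamilyMaps

variable {n : ℕ} {U : Opens (X n)} {M N : U → Type*} [∀ x, AddCommGroup (M x)]
  [∀ x, Module (DStalk (x.1 : Fin n → ℂ)) (M x)] [∀ x, AddCommGroup (N x)]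
  [∀ x, Module (DStalk (x.1 : Fin n → ℂ)) (N x)]

/-- The map of families of germs over `U` induced by linear maps between the stalks, as a linear map
over the sections of `𝒟`. -/
def mapFamily (f : ∀ x, M x →ₗ[DStalk (x.1 : Fin n → ℂ)] N x) :
    (∀ x, M x) →ₗ[DSections U] ∀ x, N x where
  toFun s x := f x (s x)
  map_add' s t := funext fun x => map_add (f x) (s x) (t x)
  map_smul' P s := funext fun x => map_smul (f x) (P.1 x) (s x)

theorem apply_mem_span_of_mem_span {ι : Type*} {g : ι → ∀ x, M x} {s : ∀ x, M x}
    (hs : s ∈ Submodule.span (DSections U) (Set.range g)) (x : U) :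
    s x ∈ Submodule.span (DStalk (x.1 : Fin n → ℂ)) (Set.range fun k => g k x) := by
  induction hs using Submodule.span_induction with
  | mem s hs =>
    obtain ⟨k, rfl⟩ := hs
    exact Submodule.subset_span ⟨k, rfl⟩
  | zero => exact Submodule.zero_mem _
  | add s t _ _ hs ht => exact Submodule.add_mem _ hs ht
  | smul P s _ hs => exact Submodule.smul_mem _ (P.1 x) hs

end FamilyMaps

section TransferModule

variable {n : ℕ} {p : Fin n → ℂ} {U : Opens (X n)}

/-- The stalk at `(0, p)` of `x₀ 𝒟`. -/
def coordZeroIdeal (p : Fin n → ℂ) : Submodule (DStalk p) (DStalk (incl p)) where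
  carrier := {P | coordD 0 ∣ P}
  zero_mem' := dvd_zero _
  add_mem' := dvd_add
  smul_mem' := by
    rintro P _ ⟨R, rfl⟩
    exact ⟨liftD p P * R, by rw [lift_smul_def, ← mul_assoc, liftD_coordD, mul_assoc]⟩

/-- The stalk at `p` of `𝒟 / x₀ 𝒟`, the restriction of `𝒟` to the hyperplane `x₀ = 0`. -/
abbrev TransferMod (p : Fin n → ℂ) : Type := DStalk (incl p) ⧸ coordZeroIdeal p

/-- The class of `∂₀ᵏ` in `𝒟 / x₀ 𝒟`. -/
def transferClass (p : Fin n → ℂ) (k : ℕ) : TransferMod p := Submodule.Quotient.mk (partialD 0 ^ k)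

/-- Right multiplication by an operator, which preserves `x₀ 𝒟`. -/
def transferMulRight (R : DStalk (incl p)) : TransferMod p →ₗ[DStalk p] TransferMod p :=
  (coordZeroIdeal p).mapQ _
    { toFun := (· * R)
      map_add' := fun P Q => add_mul P Q R
      map_smul' := fun S P => mul_assoc (liftD p S) P R }
    fun _ hP => dvd_mul_of_dvd_left hP R

/-- The families of operators along the hyperplane that modulo `x₀ 𝒟` are combinations of the `∂₀ᵏ`
with coefficients in the sections of `𝒟`. -/
def transferSections (U : Opens (X n)) :
    Submodule (DSections U) (∀ x : U, DStalk (incl (x.1 : Fin n → ℂ))) :=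
  (Submodule.span (DSections U) (Set.range fun k (x : U) => transferClass x.1 k)).comap
    (mapFamily fun x => (coordZeroIdeal x.1).mkQ)

theorem pow_mem_transferSections (k : ℕ) : (fun _ => partialD 0 ^ k) ∈ transferSections U :=
  Submodule.subset_span ⟨k, rfl⟩

theorem mul_mem_transferSections {Q R : ∀ x : U, DStalk (incl (x.1 : Fin n → ℂ))}
    (hR : ∀ k : ℕ, (fun x => partialD 0 ^ k * R x) ∈ transferSections U)
    (hQ : Q ∈ transferSections U) : (fun x => Q x * R x) ∈ transferSections U :=
  Submodule.span_le (p := Submodule.comap (mapFamily fun x => transferMulRight (R x)) _).2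
    (Set.range_subset_iff.2 hR) hQ

theorem mulD_mem_transferSections {f : (Fin (n + 1) → ℂ) → ℂ}
    (hf : ∀ x : U, AnalyticAt ℂ f (incl x.1)) :
    (fun x => mulD f (hf x)) ∈ transferSections U := by
  have hf' : ∀ x ∈ U, AnalyticAt ℂ (f ∘ incl) x := fun x hx =>
    (hf ⟨x, hx⟩).comp (analyticAt_incl x)
  let s : DSections U := ⟨mulSec U (f ∘ incl) hf',
    basicSections_le U (Algebra.subset_adjoin (Or.inl ⟨_, hf', rfl⟩))⟩
  refine (Submodule.sub_mem_iff_left _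
    (Submodule.smul_mem _ s (pow_mem_transferSections 0))).1 (Submodule.mem_comap.2 ?_)
  convert Submodule.zero_mem _
  ext1 x
  obtain ⟨h, hh, f_eq⟩ := exists_eq_pull_add_coord_mul (hf x)
  refine (Submodule.Quotient.mk_eq_zero _).2 ⟨mulD h hh, ?_⟩
  change mulD f (hf x) - liftD x.1 (mulD (f ∘ incl) (hf' x.1 x.2)) * partialD 0 ^ 0 = _
  rw [pow_zero, mul_one, liftD_mulD, sub_eq_iff_eq_add', coordD, ← mulD_mul, ← mulD_add]
  exact mulD_congr _ _ f_eq

theorem pow_mul_mulD_mem_transferSections (k : ℕ) {f : (Fin (n + 1) → ℂ) → ℂ}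
    (hf : ∀ x : U, AnalyticAt ℂ f (incl x.1)) :
    (fun x => partialD 0 ^ k * mulD f (hf x)) ∈ transferSections U := by
  induction k generalizing f with
  | zero => simpa only [pow_zero, one_mul] using mulD_mem_transferSections hf
  | succ k ih =>
    have mul_partialD := mul_mem_transferSections (R := fun _ => partialD 0)
      (fun k => by simpa only [← pow_succ] using pow_mem_transferSections (k + 1)) (ih hf)
    convert Submodule.add_mem _ mul_partialD (ih fun x => analyticAt_pderiv 0 (hf x)) using 1
    ext1 x
    rw [pow_succ, mul_assoc, partialD_mul_mulD, mul_add, ← mul_assoc]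
    rfl

theorem pow_mul_partialD_succ_mem_transferSections (k : ℕ) (i : Fin n) :
    (fun _ => partialD 0 ^ k * partialD i.succ) ∈ transferSections U := by
  convert Submodule.smul_mem _ (partialSec U i) (pow_mem_transferSections k) using 1
  ext1 x
  change _ = liftD x.1 (partialD i) * partialD 0 ^ k
  rw [liftD_partialD, ((commute_partialD 0 i.succ).pow_left k).eq]

theorem mul_basicSection_mem_transferSections {W : Opens (X (n + 1))} (hW : ∀ x ∈ U, incl x ∈ W)
    {P : ∀ y : W, DStalk (y.1 : Fin (n + 1) → ℂ)} (hP : P ∈ basicSections W)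
    {Q : ∀ x : U, DStalk (incl (x.1 : Fin n → ℂ))} (hQ : Q ∈ transferSections U) :
    (fun x => Q x * P ⟨incl x.1, hW x.1 x.2⟩) ∈ transferSections U := by
  induction hP using Algebra.adjoin_induction generalizing Q with
  | mem P hP =>
    refine mul_mem_transferSections (fun k => ?_) hQ
    obtain ⟨f, hf, rfl⟩ | ⟨i, rfl⟩ := hP
    · exact pow_mul_mulD_mem_transferSections k fun x => hf _ (hW x.1 x.2)
    · cases i using Fin.cases with
      | zero => simpa only [← pow_succ] using pow_mem_transferSections (k + 1)
      | succ i => exact pow_mul_partialD_succ_mem_transferSections k i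
  | algebraMap r =>
    convert Submodule.smul_mem _ (algebraMap ℂ (DSections U) r) hQ using 1
    ext1 x
    change Q x * algebraMap ℂ (DStalk (incl x.1)) r = liftD x.1 (algebraMap ℂ _ r) * Q x
    rw [AlgHom.commutes, Algebra.commutes]
  | add P P' _ _ hP hP' =>
    convert Submodule.add_mem _ (hP hQ) (hP' hQ) using 1
    exact funext fun x => mul_add _ _ _
  | mul P P' _ _ hP hP' =>
    convert hP' (hP hQ) using 1
    exact funext fun x => (mul_assoc _ _ _).symm

theorem mk_basicSection_mem_span_transferClass {W : Opens (X (n + 1))} (hW : ∀ x ∈ U, incl x ∈ W)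
    {P : ∀ y : W, DStalk (y.1 : Fin (n + 1) → ℂ)} (hP : P ∈ basicSections W) :
    (fun x : U => (Submodule.Quotient.mk (P ⟨incl x.1, hW x.1 x.2⟩) : TransferMod x.1)) ∈
      Submodule.span (DSections U) (Set.range fun k (x : U) => transferClass x.1 k) := by
  have mem : (fun x : U => P ⟨incl x.1, hW x.1 x.2⟩) ∈ transferSections U := by
    simpa only [pow_zero, one_mul] using
      mul_basicSection_mem_transferSections hW hP (pow_mem_transferSections 0)
  exact mem

theorem span_transferClass_eq_top :
    Submodule.span (DStalk p) (Set.range (transferClass p)) = ⊤ := by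
  refine eq_top_iff.2 fun v _ => ?_
  obtain ⟨P, rfl⟩ := Submodule.Quotient.mk_surjective _ v
  obtain ⟨W, hp, s, hs, rfl⟩ := exists_basicSection_apply_eq P
  let U : Opens (X n) := ⟨{x | incl x ∈ W}, W.2.preimage continuous_incl⟩
  exact apply_mem_span_of_mem_span
    (mk_basicSection_mem_span_transferClass (U := U) (fun _ hx => hx) hs) ⟨p, hp⟩

end TransferModule

section Freeness

variable {n : ℕ} {p : Fin n → ℂ}

instance instModuleHolGerm (p : Fin n → ℂ) : Module (DStalk p) (HolGerm p) :=
  inferInstanceAs (Module (diffOps p) (HolGerm p))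

theorem restrGerm_liftD_smul (S : DStalk p) (g : HolGerm (incl p)) :
    restrGerm p (liftD p S • g) = S • restrGerm p g := by
  obtain ⟨⟨⟨T, S⟩, hT⟩, rfl⟩ := (liftGraph_snd_bijective p).2 S
  change restrGerm p (liftD p S • g) = S • restrGerm p g
  rw [liftD_eq hT]
  exact liftGraph_spec hT 0 g

theorem restrGerm_coordD_zero_smul (g : HolGerm (incl p)) :
    restrGerm p ((coordD 0 : DStalk (incl p)) • g) = 0 := by
  induction g using HolGerm.ind with
  | h g hg =>
    refine (holGerm_eq_iff (hf := ((analyticAt_coord 0 (incl p)).mul hg).comp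
      (analyticAt_incl p)) (hg := analyticAt_const (v := (0 : ℂ)))).2 (.of_forall fun x => ?_)
    simp [incl]

theorem exists_partialD_zero_smul_eq_zero (φ : HolGerm p) :
    ∃ G : HolGerm (incl p), (partialD 0 : DStalk (incl p)) • G = 0 ∧ restrGerm p G = φ := by
  induction φ using HolGerm.ind with
  | h f hf =>
    refine ⟨(mulD (pull f) (analyticAt_pull_incl hf) : DStalk (incl p)) •
      holGerm (fun _ => 1) analyticAt_const, ?_, ?_⟩
    · have commute := LinearMap.congr_fun (partialOp_mulOp_pull hf)
        (holGerm (fun _ => 1) analyticAt_const)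
      refine commute.trans ?_
      have partial_one : (partialOp 0 (holGerm (fun _ => 1) analyticAt_const) :
          HolGerm (incl p)) = 0 :=
        (holGerm_eq_iff (hf := analyticAt_pderiv 0 analyticAt_const)
          (hg := analyticAt_const (v := (0 : ℂ)))).2 (.of_forall fun x => by simp [pderiv])
      rw [Module.End.mul_apply, partial_one, map_zero]
    · rw [← liftD_mulD hf, restrGerm_liftD_smul]
      exact (holGerm_eq_iff (hf := hf.mul (analyticAt_const.comp (analyticAt_incl p))) (hg := hf)).2
        (.of_forall fun x => mul_one (f x))

/-- The linear map `𝒟 / x₀ 𝒟 → 𝒪` applying an operator to `G` and restricting to `x₀ = 0`. -/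
def transferEval (G : HolGerm (incl p)) : TransferMod p →ₗ[DStalk p] HolGerm p :=
  (coordZeroIdeal p).liftQ
    { toFun := fun P => restrGerm p (P • G)
      map_add' := fun P Q => by rw [add_smul, map_add]
      map_smul' := fun S P => by
        rw [lift_smul_def, mul_smul, restrGerm_liftD_smul, RingHom.id_apply] }
    (by
      rintro _ ⟨R, rfl⟩
      exact (congrArg (restrGerm p) (mul_smul _ R G)).trans (restrGerm_coordD_zero_smul _))

theorem transferEval_transferClass {G : HolGerm (incl p)}
    (hG : (partialD 0 : DStalk (incl p)) • G = 0) (j k : ℕ) :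
    transferEval ((coordD 0 : DStalk (incl p)) ^ j • G) (transferClass p k) =
      if k = j then j.factorial • restrGerm p G else 0 := by
  refine (congrArg (restrGerm p)
    ((weylRelations_DStalk (incl p)).pow_smul_pow_smul hG k j)).trans ?_
  rw [map_nsmul]
  rcases lt_trichotomy k j with h | rfl | h
  · rw [if_neg h.ne, ← Nat.sub_add_cancel (Nat.sub_pos_of_lt h), pow_succ', mul_smul,
      restrGerm_coordD_zero_smul, smul_zero]
  · rw [if_pos rfl, Nat.descFactorial_self, Nat.sub_self, pow_zero, one_smul]
  · rw [if_neg h.ne', Nat.descFactorial_of_lt h, zero_smul]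

theorem linearIndependent_transferClass : LinearIndependent (DStalk p) (transferClass p) := by
  refine linearIndependent_iff.2 fun l hl => Finsupp.ext fun j =>
    Subtype.ext (LinearMap.ext fun φ => ?_)
  obtain ⟨G, hG, rfl⟩ := exists_partialD_zero_smul_eq_zero φ
  have eval := congrArg (transferEval ((coordD 0 : DStalk (incl p)) ^ j • G)) hl
  rw [map_zero, Finsupp.linearCombination_apply, map_finsuppSum] at eval
  simp only [map_smul, transferEval_transferClass hG, smul_ite, smul_zero, smul_comm (N := ℕ),
    Finsupp.sum_ite_eq'] at eval
  by_cases hj : j ∈ l.support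
  · rw [if_pos hj] at eval
    rw [← Nat.cast_smul_eq_nsmul ℂ] at eval
    exact (smul_eq_zero.1 eval).resolve_left (Nat.cast_ne_zero.2 j.factorial_ne_zero)
  · rw [Finsupp.notMem_support_iff.1 hj]
    rfl

/-- The `𝒟`-module `𝒟 / x₀ 𝒟` on the hyperplane is free on the powers of `∂₀`. -/
def transferBasis (p : Fin n → ℂ) : Module.Basis ℕ (DStalk p) (TransferMod p) :=
  .mk linearIndependent_transferClass span_transferClass_eq_top.ge

theorem transferBasis_apply (k : ℕ) : transferBasis p k = transferClass p k :=
  Module.Basis.mk_apply _ _ k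

end Freeness

/-! ### Sheaves of `𝒟`-modules with prescribed stalks -/

section Sheaves

variable {n : ℕ} {N N' : X n → Type} [∀ x, AddCommGroup (N x)]
  [∀ x, Module (DStalk (x : Fin n → ℂ)) (N x)] [∀ x, AddCommGroup (N' x)]
  [∀ x, Module (DStalk (x : Fin n → ℂ)) (N' x)]

/-- The condition on `B` under which the families of germs locally in `B` are the sections of a
sheaf of `𝒟`-modules. -/
structure IsModulePrelocal (B : TopCat.PrelocalPredicate N) : Prop where
  zero : ∀ U : Opens (X n), B.pred (0 : ∀ x : U, N x)
  add : ∀ {U : Opens (X n)} {s t : ∀ x : U, N x}, B.pred s → B.pred t → B.pred (s + t)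
  smul : ∀ {U : Opens (X n)} {P : ∀ x : U, DStalk (x.1 : Fin n → ℂ)} {s : ∀ x : U, N x},
    P ∈ basicSections U → B.pred s → B.pred fun x => P x • s x

/-- `B` consists of the families of germs that are locally combinations of the global families `g`
with coefficients in the sections of `𝒟`. -/
structure IsGeneratedBy {ι : Type*} (B : TopCat.PrelocalPredicate N) (g : ι → ∀ x : X n, N x) :
    Prop where
  exists_mem_span : ∀ {U : Opens (X n)} {s : ∀ x : U, N x}, B.pred s → ∀ x : U,
    ∃ (V : Opens (X n)) (_ : x.1 ∈ V) (hV : V ≤ U), (fun y : V => s ⟨y.1, hV y.2⟩) ∈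
      Submodule.span (DSections V) (Set.range fun k (y : V) => g k y)

variable {B : TopCat.PrelocalPredicate N} {B' : TopCat.PrelocalPredicate N'} {ι ι' : Type*}
  {g : ι → ∀ x : X n, N x} {g' : ι' → ∀ x : X n, N' x}

namespace IsModulePrelocal

/-- The sections over `U` of the sheaf of `𝒟`-modules defined by `B`. -/
abbrev sections (hB : IsModulePrelocal B) (U : Opens (X n)) :
    Submodule (DSections U) (∀ x : U, N x) :=
  modSections N B hB.zero hB.add hB.smul U

/-- The sheaf of `𝒟`-modules defined by `B`. -/
abbrev sheaf (hB : IsModulePrelocal B) : SheafOfModules (DSheaf n) :=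
  modSheaf N B hB.zero hB.add hB.smul

theorem map_mem_sections (hB : IsModulePrelocal B) (hB' : IsModulePrelocal B')
    (hg : IsGeneratedBy B g) (f : ∀ x : X n, N x →ₗ[DStalk (x : Fin n → ℂ)] N' x)
    (hf : ∀ k U, (fun x : U => f x (g k x)) ∈ hB'.sections U) {U : Opens (X n)}
    {s : ∀ x : U, N x} (hs : s ∈ hB.sections U) : (fun x : U => f x (s x)) ∈ hB'.sections U := by
  refine B'.sheafify.locality (fun x : U => f x (s x)) fun x => ?_
  obtain ⟨V, hxV, i, hsV⟩ := hs x
  obtain ⟨W, hxW, hWV, hsW⟩ := hg.exists_mem_span hsV ⟨x.1, hxV⟩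
  have span_le : Submodule.span (DSections W) (Set.range fun k (y : W) => g k y) ≤
      (hB'.sections W).comap (mapFamily fun y => f y.1) :=
    Submodule.span_le.2 (Set.range_subset_iff.2 fun k => hf k W)
  exact ⟨W, hxW, homOfLE hWV ≫ i, span_le hsW⟩

theorem nonempty_sheaf_iso (hB : IsModulePrelocal B) (hB' : IsModulePrelocal B')
    (hg : IsGeneratedBy B g) (hg' : IsGeneratedBy B' g')
    (e : ∀ x : X n, N x ≃ₗ[DStalk (x : Fin n → ℂ)] N' x)
    (he : ∀ k U, (fun x : U => e x (g k x)) ∈ hB'.sections U)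
    (he' : ∀ k U, (fun x : U => (e x).symm (g' k x)) ∈ hB.sections U) :
    Nonempty (hB.sheaf ≅ hB'.sheaf) := by
  let sectionsEquiv (U : (Opens (X n))ᵒᵖ) :
      hB.sections U.unop ≃ₗ[(DSheaf n).obj.obj U] hB'.sections U.unop :=
    { toFun := fun s => ⟨fun x => e x.1 (s.1 x),
        map_mem_sections hB hB' hg (fun x => (e x).toLinearMap) he s.2⟩
      invFun := fun s => ⟨fun x => (e x.1).symm (s.1 x),
        map_mem_sections hB' hB hg' (fun x => (e x).symm.toLinearMap) he' s.2⟩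
      map_add' := fun s t => Subtype.ext (funext fun x => map_add (e x.1) (s.1 x) (t.1 x))
      map_smul' := fun P s => Subtype.ext (funext fun x =>
        map_smul (e x.1) ((show DSections U.unop from P).1 x) (s.1 x))
      left_inv := fun s => Subtype.ext (funext fun x => (e x.1).symm_apply_apply (s.1 x))
      right_inv := fun s => Subtype.ext (funext fun x => (e x.1).apply_symm_apply (s.1 x)) }
  let presheafIso : modPresheaf N B hB.zero hB.add hB.smul ≅
      modPresheaf N' B' hB'.zero hB'.add hB'.smul :=
    PresheafOfModules.isoMk (fun U => (sectionsEquiv U).toModuleIso) fun U V i => rfl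
  exact ⟨(SheafOfModules.fullyFaithfulForget (DSheaf n)).preimageIso presheafIso⟩

end IsModulePrelocal

theorem IsEulerFamily.pi {a : Fin n → ℕ} {β : ℂ} {T : Set ℕ} {U : Opens (X n)}
    {ψ : ℕ → ∀ x : U, N x} (hT : ∀ j ∈ T, ∀ i, j + a i ∈ T) (h : ∀ x : U, IsEulerFamily
      (fun i => (coordD i : DStalk (x.1 : Fin n → ℂ))) partialD a β T fun j => ψ j x) :
    IsEulerFamily (coordSec U) (partialSec U) a β T ψ where
  add_mem := hT
  partial_smul j hj i := funext fun x => (h x).partial_smul j hj i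
  euler_smul j hj := funext fun x => by
    have euler_smul_apply := (h x).euler_smul j hj
    rw [eulerSum_smul] at euler_smul_apply ⊢
    rw [Finset.sum_apply]
    exact euler_smul_apply

theorem IsModulePrelocal.eulerFamily_mem_sections (hB : IsModulePrelocal B) {a : Fin n → ℕ}
    {β : ℂ} {T : Set ℕ} {ψ : ℕ → ∀ x : X n, N x}
    (h : ∀ x : X n, IsEulerFamily (fun i => (coordD i : DStalk (x : Fin n → ℂ))) partialD a β
      Set.univ fun j => ψ j x)
    (ha : ∀ i, 0 < a i) (hT : ∀ᶠ j in atTop, j ∈ T) (hβ : ∀ j ∉ T, β ≠ (j : ℕ))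
    {U : Opens (X n)} (hψ : ∀ j ∈ T, (fun x : U => ψ j x) ∈ hB.sections U) (j : ℕ) :
    (fun x : U => ψ j x) ∈ hB.sections U :=
  (IsEulerFamily.pi (T := Set.univ) (ψ := fun j (x : U) => ψ j x) (fun _ _ _ => trivial)
    fun x => h x.1).forall_mem ha hT hβ (hB.sections U) hψ j

theorem exists_modSheaf_eq_sheaf {h0 : ∀ U : Opens (X n), B.pred (0 : ∀ x : U, N x)}
    {hadd : ∀ {U : Opens (X n)} {s t : ∀ x : U, N x}, B.pred s → B.pred t → B.pred (s + t)}
    {hsmul : ∀ {U : Opens (X n)} {P : ∀ x : U, DStalk (x.1 : Fin n → ℂ)} {s : ∀ x : U, N x},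
      P ∈ basicSections U → B.pred s → B.pred fun x => P x • s x} :
    ∃ hB : IsModulePrelocal B, modSheaf N B h0 @hadd @hsmul = hB.sheaf :=
  ⟨⟨h0, hadd, hsmul⟩, rfl⟩

theorem exists_hypSheaf_eq_sheaf (a : Fin n → ℤ) (β : ℂ) :
    ∃ hB : IsModulePrelocal (hypPrelocal a β), hypSheaf a β = hB.sheaf := by
  unfold hypSheaf
  apply exists_modSheaf_eq_sheaf

theorem exists_restrSheaf_eq_sheaf (a' : Fin (n + 1) → ℤ) (β : ℂ) :
    ∃ hB : IsModulePrelocal (restrPrelocal a' β), restrSheaf a' β = hB.sheaf := by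
  unfold restrSheaf
  apply exists_modSheaf_eq_sheaf

end Sheaves

/-! ### The stalks of the hypergeometric modules -/

section Hypergeometric

variable {n : ℕ} {a : Fin n → ℕ} {β : ℂ} {p : Fin n → ℂ}

/-- The germ at `p` of an element of the Weyl algebra. -/
def weylEval (p : Fin n → ℂ) : Weyl n →ₐ[ℂ] DStalk p :=
  (Pi.evalAlgHom ℂ (fun p : Fin n → ℂ => DStalk p) p).comp (Weyl n).val

theorem weylEval_toricOp (u : Fin n → ℤ) : weylEval p (toricOp u) =
    ordPow partialD (fun i => (u i).toNat) - ordPow partialD fun i => (-u i).toNat := by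
  rw [toricOp, map_sub]
  exact congrArg₂ _ (map_ordPow (weylEval p) wd _) (map_ordPow (weylEval p) wd _)

theorem weylEval_eulerOp : weylEval p (eulerOp (fun i => (a i : ℤ)) β) =
    eulerSum (fun i => coordD i) partialD a - algebraMap ℂ (DStalk p) β := by
  rw [eulerOp, map_sub, AlgHom.commutes, map_sum, eulerSum]
  congr 1
  refine Finset.sum_congr rfl fun i _ => ?_
  rw [map_smul, map_mul, Int.cast_natCast, Nat.cast_smul_eq_nsmul]
  rfl

theorem weylEval_mem_hypStalk {P : Weyl n} {b : Fin n → ℤ} (hP : P ∈ hypIdeal b β) :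
    weylEval p P ∈ hypStalk b β p :=
  Submodule.subset_span ⟨P, hP, rfl⟩

theorem toNat_dotProduct_eq {u : Fin n → ℤ} (hu : ∑ i, (a i : ℤ) * u i = 0) :
    (fun i => (u i).toNat) ⬝ᵥ a = (fun i => (-u i).toNat) ⬝ᵥ a := by
  simp only [dotProduct]
  zify
  rw [← sub_eq_zero, ← Finset.sum_sub_distrib, ← hu]
  refine Finset.sum_congr rfl fun i _ => ?_
  rw [← sub_mul, mul_comm, Int.toNat_sub_toNat_neg]

theorem hypStalk_le {I : Submodule (DStalk p) (DStalk p)}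
    (htoric : ∀ u v : Fin n → ℕ, u ⬝ᵥ a = v ⬝ᵥ a → ordPow partialD u - ordPow partialD v ∈ I)
    (heuler : eulerSum (fun i => coordD i) partialD a - algebraMap ℂ _ β ∈ I) :
    hypStalk (fun i => (a i : ℤ)) β p ≤ I := by
  suffices h : ∀ P ∈ hypIdeal (fun i => (a i : ℤ)) β, weylEval p P ∈ I from
    Submodule.span_le.2 (Set.forall_mem_image.2 h)
  intro P hP
  induction hP using Submodule.span_induction with
  | mem P hP =>
    obtain ⟨u, hu, rfl⟩ | rfl := hP
    · rw [weylEval_toricOp]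
      exact htoric _ _ (toNat_dotProduct_eq hu)
    · rwa [weylEval_eulerOp]
  | zero => rw [map_zero]; exact I.zero_mem
  | add P Q _ _ hP hQ => rw [map_add]; exact I.add_mem hP hQ
  | smul P Q _ hQ => rw [smul_eq_mul, map_mul]; exact I.smul_mem _ hQ

/-- Cancelling the common factor `∂^(u ⊓ v)` leaves a binomial with exponents of disjoint
supports. -/
theorem ordPow_sub_ordPow_mem_hypStalk {u v : Fin n → ℕ} (h : u ⬝ᵥ a = v ⬝ᵥ a) :
    ordPow partialD u - ordPow partialD v ∈ hypStalk (fun i => (a i : ℤ)) β p := by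
  let w : Fin n → ℤ := fun i => u i - v i
  have hu : u = u ⊓ v + fun i => (w i).toNat := by ext i; simp [w]; omega
  have hv : v = u ⊓ v + fun i => (-w i).toNat := by ext i; simp [w]; omega
  have toricOp_mem : toricOp w ∈ hypIdeal (fun i => (a i : ℤ)) β := by
    refine Submodule.subset_span (Or.inl ⟨w, ?_, rfl⟩)
    simp only [dotProduct] at h
    zify at h
    simp only [w, mul_comm (a _ : ℤ), sub_mul, Finset.sum_sub_distrib, h, sub_self]
  have mul_mem := Submodule.smul_mem _ (ordPow (partialD : Fin n → DStalk p) (u ⊓ v))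
    (weylEval_mem_hypStalk (p := p) toricOp_mem)
  rwa [weylEval_toricOp, smul_eq_mul, mul_sub, ← ordPow_add commute_partialD,
    ← ordPow_add commute_partialD, ← hu, ← hv] at mul_mem

theorem eulerSum_sub_mem_hypStalk :
    eulerSum (fun i => coordD i) partialD a - algebraMap ℂ _ β ∈
      hypStalk (fun i => (a i : ℤ)) β p := by
  rw [← weylEval_eulerOp]
  exact weylEval_mem_hypStalk (Submodule.subset_span (Or.inr rfl))

/-- The class `monomialClass a β p j` in the stalk at `p` of `ℳ_a(β)` of the monomials `∂ᵘ` with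
`∑ aᵢ uᵢ = j`, or `0` if there are none. -/
def monomialClass (a : Fin n → ℕ) (β : ℂ) (p : Fin n → ℂ) :
    ℕ → HypMod (fun i => (a i : ℤ)) β p :=
  Function.extend (· ⬝ᵥ a) (fun u => Submodule.Quotient.mk (ordPow partialD u)) 0

theorem monomialClass_dotProduct (u : Fin n → ℕ) :
    monomialClass a β p (u ⬝ᵥ a) = Submodule.Quotient.mk (ordPow partialD u) :=
  Function.FactorsThrough.extend_apply (fun _ _ h =>
    (Submodule.Quotient.eq _).2 (ordPow_sub_ordPow_mem_hypStalk h)) 0 u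

theorem monomialClass_zero : monomialClass a β p 0 = Submodule.Quotient.mk 1 := by
  rw [← zero_dotProduct a, monomialClass_dotProduct, ordPow_zero]

theorem mem_closure_range_iff_exists_dotProduct {j : ℕ} :
    j ∈ AddSubmonoid.closure (Set.range a) ↔ ∃ u : Fin n → ℕ, u ⬝ᵥ a = j := by
  simp only [AddSubmonoid.mem_closure_range_iff_of_fintype, dotProduct, smul_eq_mul, eq_comm]

theorem isUniversalEulerFamily_monomialClass :
    IsUniversalEulerFamily (fun i => (coordD i : DStalk p)) partialD a β
      (AddSubmonoid.closure (Set.range a) : Set ℕ) (monomialClass a β p) where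
  toIsEulerFamily := .of_closure (weylRelations_DStalk p)
    (by
      intro j hj i
      obtain ⟨u, rfl⟩ := mem_closure_range_iff_exists_dotProduct.1 hj
      rw [monomialClass_dotProduct, ← single_one_dotProduct i a, ← add_dotProduct, add_comm u,
        monomialClass_dotProduct, ordPow_add commute_partialD, ordPow_single, pow_one]
      rfl)
    (by
      rw [monomialClass_zero, ← Submodule.Quotient.mk_smul, ← Submodule.Quotient.mk_smul,
        smul_eq_mul, smul_eq_mul, mul_one, mul_one]
      exact (Submodule.Quotient.eq _).2 eulerSum_sub_mem_hypStalk)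
  span_eq_top := by
    refine eq_top_iff.2 fun v _ => ?_
    obtain ⟨P, rfl⟩ := Submodule.Quotient.mk_surjective _ v
    rw [← mul_one P, ← smul_eq_mul, Submodule.Quotient.mk_smul, ← monomialClass_zero]
    exact Submodule.smul_mem _ P (Submodule.subset_span ⟨0, zero_mem _, rfl⟩)
  exists_lift {N} _ _ φ hφ := by
    have h0 : 0 ∈ (AddSubmonoid.closure (Set.range a) : Set ℕ) := zero_mem _
    refine ⟨(hypStalk _ β p).liftQ (LinearMap.toSpanSingleton (DStalk p) N (φ 0))
      (hypStalk_le (fun u v huv => ?_) ?_), fun j hj => ?_⟩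
    · rw [LinearMap.mem_ker, LinearMap.toSpanSingleton_apply, sub_smul, hφ.ordPow_smul u h0,
        hφ.ordPow_smul v h0, huv, sub_self]
    · rw [LinearMap.mem_ker, LinearMap.toSpanSingleton_apply, sub_smul, hφ.euler_smul 0 h0,
        Nat.cast_zero, sub_zero, sub_self]
    · obtain ⟨u, rfl⟩ := mem_closure_range_iff_exists_dotProduct.1 hj
      rw [monomialClass_dotProduct]
      exact (hφ.ordPow_smul u h0).trans (by rw [zero_add])

theorem isGeneratedBy_monomialClass_zero :
    IsGeneratedBy (hypPrelocal (fun i => (a i : ℤ)) β)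
      fun (_ : Unit) (x : X n) => monomialClass a β x 0 := by
  constructor
  rintro U s ⟨P, hP, hs⟩ x
  refine ⟨U, x.2, le_rfl, ?_⟩
  convert Submodule.smul_mem _ (⟨P, hP⟩ : DSections U)
    (Submodule.subset_span (Set.mem_range_self ())) using 1
  ext1 y
  rw [hs, ← mul_one (P y), ← smul_eq_mul, Submodule.Quotient.mk_smul, ← monomialClass_zero]
  rfl

theorem hypPrelocal_pred_monomialClass {j : ℕ} (hj : j ∈ AddSubmonoid.closure (Set.range a))
    (U : Opens (X n)) :
    (hypPrelocal (fun i => (a i : ℤ)) β).pred fun x : U => monomialClass a β x.1 j := by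
  obtain ⟨u, rfl⟩ := mem_closure_range_iff_exists_dotProduct.1 hj
  refine ⟨_, (ordPow (partialSec U) u).2, fun x => ?_⟩
  refine (monomialClass_dotProduct u).trans ?_
  exact congrArg Submodule.Quotient.mk (map_ordPow ((Pi.evalAlgHom ℂ
    (fun x : U => DStalk (x.1 : Fin n → ℂ)) x).comp (DSections U).val) (partialSec U) u).symm

end Hypergeometric

/-! ### The stalks of the restriction -/

section Restriction

variable {n : ℕ} {a : Fin n → ℕ} {β : ℂ} {p : Fin n → ℂ}

/-- The row `(1 a₁ … aₙ)`. -/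
def consRow (a : Fin n → ℕ) : Fin (n + 1) → ℤ :=
  fun i => ((Fin.cons 1 a : Fin (n + 1) → ℕ) i : ℤ)

theorem partialD_zero_pow_mul_ordPow (k : ℕ) (u : Fin (n + 1) → ℕ) :
    partialD 0 ^ k * ordPow (partialD : Fin (n + 1) → DStalk (incl p)) u =
      ordPow (partialD : Fin n → DStalk p) (Fin.tail u) • partialD 0 ^ (k + u 0) := by
  have liftD_ordPow : liftD p (ordPow partialD (Fin.tail u)) =
      ordPow (Fin.tail partialD) (Fin.tail u) := by
    rw [map_ordPow]
    exact congrArg (ordPow · _) (funext fun i => liftD_partialD i)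
  rw [lift_smul_def, ordPow_succ, ← mul_assoc, ← pow_add, liftD_ordPow]
  exact (commute_ordPow (fun i => (commute_partialD 0 i.succ).pow_left _) _).eq

theorem eulerSum_cons :
    eulerSum (fun i => (coordD i : DStalk (incl p))) partialD (Fin.cons 1 a : Fin (n + 1) → ℕ) =
      coordD 0 * partialD 0 + liftD p (eulerSum (fun i => coordD i) partialD a) := by
  simp only [eulerSum, Fin.sum_univ_succ, Fin.cons_zero, Fin.cons_succ, one_smul, map_sum,
    map_nsmul, map_mul, liftD_partialD, coordD, liftD_mulD]
  rfl

theorem partialD_zero_pow_mul_eulerSum_sub (k : ℕ) :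
    partialD 0 ^ k * (eulerSum (fun i => (coordD i : DStalk (incl p))) partialD
      (Fin.cons 1 a : Fin (n + 1) → ℕ) - algebraMap ℂ _ β) =
      (eulerSum (fun i => coordD i) partialD a - algebraMap ℂ (DStalk p) (β - k)) •
        (partialD 0 ^ k : DStalk (incl p)) + coordD 0 * partialD 0 ^ (k + 1) := by
  rw [mul_sub, (weylRelations_DStalk (incl p)).pow_mul_eulerSum, ← Algebra.commutes, eulerSum_cons,
    lift_smul_def, map_sub, AlgHom.commutes, map_sub, map_natCast, Fin.cons_zero, mul_one,
    nsmul_eq_mul, pow_succ']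
  noncomm_ring

theorem mem_restrStalk_of_mem_hypStalk {a' : Fin (n + 1) → ℤ} {P : DStalk (incl p)}
    (hP : P ∈ hypStalk a' β (incl p)) : P ∈ restrStalk a' β p :=
  ⟨P, hP, 0, by rw [mul_zero, add_zero]⟩

theorem coordZeroIdeal_le_restrStalk {a' : Fin (n + 1) → ℤ} :
    coordZeroIdeal p ≤ restrStalk a' β p := by
  rintro _ ⟨R, rfl⟩
  exact ⟨0, Submodule.zero_mem _, R, by rw [zero_add]⟩

/-- The projection of `𝒟 / x₀ 𝒟` onto the restriction of the hypergeometric module. -/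
def restrProj (a' : Fin (n + 1) → ℤ) (β : ℂ) (p : Fin n → ℂ) :
    TransferMod p →ₗ[DStalk p] RestrMod a' β p :=
  Submodule.factor coordZeroIdeal_le_restrStalk

/-- The class of `∂₀ᵏ` in the restriction of `ℳ_(1 a)(β)`. -/
def powClass (a : Fin n → ℕ) (β : ℂ) (p : Fin n → ℂ) (k : ℕ) : RestrMod (consRow a) β p :=
  restrProj _ β p (transferClass p k)

theorem isEulerFamily_powClass :
    IsEulerFamily (fun i => (coordD i : DStalk p)) partialD a β Set.univ (powClass a β p) where
  add_mem _ _ _ := trivial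
  partial_smul k _ i := by
    refine (Submodule.Quotient.eq _).2 (mem_restrStalk_of_mem_hypStalk ?_)
    have binomial_mem := ordPow_sub_ordPow_mem_hypStalk (a := (Fin.cons 1 a : Fin (n + 1) → ℕ))
      (β := β) (p := incl p) (u := Pi.single i.succ 1 + Pi.single 0 k)
      (v := Pi.single 0 (k + a i)) (by simp [add_dotProduct, add_comm])
    rw [ordPow_add commute_partialD, ordPow_single, ordPow_single, ordPow_single,
      pow_one] at binomial_mem
    change liftD p (partialD i) * partialD 0 ^ k - _ ∈ _
    rwa [liftD_partialD]
  euler_smul k _ := by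
    refine (Submodule.Quotient.eq _).2 ⟨_, Submodule.smul_mem _ (partialD 0 ^ k)
      (eulerSum_sub_mem_hypStalk (a := (Fin.cons 1 a : Fin (n + 1) → ℕ)) (β := β)),
      -partialD 0 ^ (k + 1), ?_⟩
    refine (sub_smul _ _ (partialD 0 ^ k : DStalk (incl p))).symm.trans ?_
    rw [smul_eq_mul, partialD_zero_pow_mul_eulerSum_sub, mul_neg, add_neg_cancel_right]

/-- The largest left ideal of `𝒟` annihilated by a map on `𝒟 / x₀ 𝒟`. -/
def transferKer {N : Type*} [AddCommGroup N] [Module (DStalk p) N]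
    (f : TransferMod p →ₗ[DStalk p] N) : Submodule (DStalk (incl p)) (DStalk (incl p)) where
  carrier := {Q | ∀ P, f (Submodule.Quotient.mk (P * Q)) = 0}
  zero_mem' P := by rw [mul_zero, Submodule.Quotient.mk_zero, map_zero]
  add_mem' hQ hR P := by rw [mul_add, Submodule.Quotient.mk_add, map_add, hQ, hR, add_zero]
  smul_mem' R Q hQ P := by rw [smul_eq_mul, ← mul_assoc, hQ]

theorem mem_transferKer {N : Type*} [AddCommGroup N] [Module (DStalk p) N]
    {f : TransferMod p →ₗ[DStalk p] N} {Q : DStalk (incl p)}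
    (h : ∀ k : ℕ, f (Submodule.Quotient.mk (partialD 0 ^ k * Q)) = 0) : Q ∈ transferKer f := by
  have comp_eq_zero : f ∘ₗ transferMulRight Q = 0 :=
    LinearMap.ext_on_range span_transferClass_eq_top h
  exact fun P => LinearMap.congr_fun comp_eq_zero (Submodule.Quotient.mk P)

theorem hypStalk_le_transferKer {N : Type*} [AddCommGroup N] [Module (DStalk p) N]
    {φ : ℕ → N} (hφ : IsEulerFamily (fun i => (coordD i : DStalk p)) partialD a β Set.univ φ)
    {f : TransferMod p →ₗ[DStalk p] N} (hf : ∀ k, f (transferClass p k) = φ k) :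
    hypStalk (consRow a) β (incl p) ≤ transferKer f := by
  refine hypStalk_le (fun u v huv => mem_transferKer fun k => ?_) (mem_transferKer fun k => ?_)
  · have apply_monomial (u : Fin (n + 1) → ℕ) :
        f (Submodule.Quotient.mk (partialD 0 ^ k * ordPow partialD u)) =
          φ (k + u ⬝ᵥ (Fin.cons 1 a : Fin (n + 1) → ℕ)) := by
      rw [partialD_zero_pow_mul_ordPow, Submodule.Quotient.mk_smul, map_smul]
      refine (congrArg _ (hf _)).trans ?_
      rw [hφ.ordPow_smul _ trivial, add_assoc]
      simp [dotProduct, Fin.sum_univ_succ, Fin.tail]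
    rw [mul_sub, Submodule.Quotient.mk_sub, map_sub, apply_monomial, apply_monomial, huv, sub_self]
  · have coordD_mul_eq_zero : (Submodule.Quotient.mk (coordD 0 * partialD 0 ^ (k + 1)) :
        TransferMod p) = 0 := (Submodule.Quotient.mk_eq_zero _).2 (dvd_mul_right _ _)
    rw [partialD_zero_pow_mul_eulerSum_sub, Submodule.Quotient.mk_add, coordD_mul_eq_zero, add_zero,
      Submodule.Quotient.mk_smul, map_smul]
    refine (congrArg _ (hf k)).trans ?_
    rw [sub_smul, hφ.euler_smul k trivial, sub_self]

theorem isUniversalEulerFamily_powClass :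
    IsUniversalEulerFamily (fun i => (coordD i : DStalk p)) partialD a β Set.univ
      (powClass a β p) where
  toIsEulerFamily := isEulerFamily_powClass
  span_eq_top := by
    have range_eq : powClass a β p '' Set.univ =
        restrProj _ β p '' Set.range (transferClass p) := by
      rw [Set.image_univ, ← Set.range_comp]
      rfl
    rw [range_eq, Submodule.span_image, span_transferClass_eq_top, Submodule.map_top,
      LinearMap.range_eq_top]
    exact Submodule.factor_surjective coordZeroIdeal_le_restrStalk
  exists_lift {N} _ _ φ hφ := by
    let f : TransferMod p →ₗ[DStalk p] N := (transferBasis p).constr ℕ φ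
    have hf (k : ℕ) : f (transferClass p k) = φ k := by
      rw [← transferBasis_apply, Module.Basis.constr_basis]
    refine ⟨(restrStalk (consRow a) β p).liftQ (f ∘ₗ (coordZeroIdeal p).mkQ) ?_, fun k _ => hf k⟩
    rintro _ ⟨Q, hQ, R, rfl⟩
    have apply_Q : f (Submodule.Quotient.mk Q) = 0 := by
      simpa only [one_mul] using hypStalk_le_transferKer hφ hf hQ 1
    have mk_eq_zero : (Submodule.Quotient.mk (coordD 0 * R) : TransferMod p) = 0 :=
      (Submodule.Quotient.mk_eq_zero _).2 (dvd_mul_right _ _)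
    change f (Submodule.Quotient.mk (Q + coordD 0 * R)) = 0
    rw [Submodule.Quotient.mk_add, mk_eq_zero, add_zero, apply_Q]

theorem restrPrelocal_pred_powClass (k : ℕ) (U : Opens (X n)) :
    (restrPrelocal (consRow a) β).pred fun x : U => powClass a β x.1 k :=
  ⟨⊤, _, (partialSec ⊤ 0 ^ k).2, fun _ _ => trivial, fun _ => rfl⟩

theorem isGeneratedBy_powClass :
    IsGeneratedBy (restrPrelocal (consRow a) β) fun k (x : X n) => powClass a β x k := by
  constructor
  rintro U s ⟨W, P, hP, hW, hs⟩ x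
  obtain ⟨W', hxW', i, hPW'⟩ := hP ⟨incl x.1, hW x.1 x.2⟩
  let V : Opens (X n) := U ⊓ ⟨{y | incl y ∈ W'}, W'.2.preimage continuous_incl⟩
  have span_le : Submodule.span (DSections V) (Set.range fun k (y : V) => transferClass y.1 k) ≤
      (Submodule.span (DSections V) (Set.range fun k (y : V) => powClass a β y.1 k)).comap
        (mapFamily fun y => restrProj (consRow a) β y.1) :=
    Submodule.span_le.2 (Set.range_subset_iff.2 fun k => Submodule.subset_span ⟨k, rfl⟩)
  refine ⟨V, ⟨x.2, hxW'⟩, inf_le_left, ?_⟩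
  simp only [hs]
  exact span_le (mk_basicSection_mem_span_transferClass (U := V) (fun y hy => hy.2) hPW')

end Restriction

/-! ### The isomorphism -/

section Isomorphism

variable {n : ℕ} {a : Fin n → ℕ} {β : ℂ}

theorem exists_stalkwise_equiv (ha : ∀ i, 0 < a i) {m : ℕ}
    (hS : ∀ᶠ j in atTop, j ∈ AddSubmonoid.closure (Set.range a))
    (hm : ∀ j < m, β + m ≠ (j : ℕ))
    (hβ : ∀ j ∉ AddSubmonoid.closure (Set.range a), β + m ≠ (j : ℕ)) (p : Fin n → ℂ) :
    ∃ (φ : ℕ → RestrMod (consRow a) β p) (ψ : ℕ → HypMod (fun i => (a i : ℤ)) (β + m) p)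
      (e : RestrMod (consRow a) β p ≃ₗ[DStalk p] HypMod (fun i => (a i : ℤ)) (β + m) p),
      IsEulerFamily (fun i => (coordD i : DStalk p)) partialD a (β + m) Set.univ φ ∧
      IsEulerFamily (fun i => (coordD i : DStalk p)) partialD a (β + m) Set.univ ψ ∧
      (∀ j, φ (j + m) = powClass a β p j) ∧
      Set.EqOn ψ (monomialClass a (β + m) p) (AddSubmonoid.closure (Set.range a)) ∧
      ∀ j, e (φ j) = ψ j := by
  obtain ⟨φ, hφ, φ_add⟩ := isUniversalEulerFamily_powClass.exists_shift
    (weylRelations_DStalk p) ha hm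
  obtain ⟨ψ, hψ, ψ_eq⟩ := isUniversalEulerFamily_monomialClass.exists_extension
    (weylRelations_DStalk p) ha hS hβ
  obtain ⟨e, he⟩ := hφ.exists_linearEquiv hψ
  exact ⟨φ, ψ, e, hφ.toIsEulerFamily, hψ.toIsEulerFamily, φ_add, ψ_eq, fun j => he j trivial⟩

theorem nonempty_restrSheaf_iso_hypSheaf (ha : ∀ i, 0 < a i) {m : ℕ}
    (hS : ∀ᶠ j in atTop, j ∈ AddSubmonoid.closure (Set.range a))
    (hm : ∀ j < m, β + m ≠ (j : ℕ))
    (hβ : ∀ j ∉ AddSubmonoid.closure (Set.range a), β + m ≠ (j : ℕ)) :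
    Nonempty (restrSheaf (consRow a) β ≅ hypSheaf (fun i => (a i : ℤ)) (β + m)) := by
  obtain ⟨hR, restr_eq⟩ := exists_restrSheaf_eq_sheaf (consRow a) β
  obtain ⟨hH, hyp_eq⟩ := exists_hypSheaf_eq_sheaf (fun i => (a i : ℤ)) (β + m)
  choose φ ψ e hφ hψ φ_add ψ_eq he using
    exists_stalkwise_equiv (n := n) ha hS hm hβ
  have φ_mem {U : Opens (X n)} (j : ℕ) : (fun x : U => φ x j) ∈ hR.sections U := by
    refine hR.eulerFamily_mem_sections (ψ := fun j x => φ x j) (fun x => hφ x) ha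
      (eventually_ge_atTop m) (fun j hj => hm j (not_le.1 hj)) (fun j hj => ?_) j
    obtain ⟨k, rfl⟩ := Nat.exists_eq_add_of_le' hj
    simp only [φ_add]
    exact TopCat.PrelocalPredicate.sheafifyOf (restrPrelocal_pred_powClass k U)
  have ψ_mem {U : Opens (X n)} (j : ℕ) : (fun x : U => ψ x j) ∈ hH.sections U := by
    refine hH.eulerFamily_mem_sections (ψ := fun j x => ψ x j) (fun x => hψ x) ha hS hβ
      (fun j hj => ?_) j
    simp only [ψ_eq _ hj]
    exact TopCat.PrelocalPredicate.sheafifyOf (hypPrelocal_pred_monomialClass hj U)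
  rw [restr_eq, hyp_eq]
  refine hR.nonempty_sheaf_iso hH isGeneratedBy_powClass isGeneratedBy_monomialClass_zero e
    (fun k U => ?_) (fun _ U => ?_)
  · simp only [← φ_add, he]
    exact ψ_mem _
  · simp only [← ψ_eq _ (zero_mem (AddSubmonoid.closure (Set.range a))), ← he,
      LinearEquiv.symm_apply_apply]
    exact φ_mem _

theorem nonempty_restrSheaf_iso_hypSheaf_of_not_gap (ha : ∀ i, 0 < a i)
    (hS : ∀ᶠ j in atTop, j ∈ AddSubmonoid.closure (Set.range a))
    (hβ : ∀ j ∉ AddSubmonoid.closure (Set.range a), β ≠ (j : ℕ)) :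
    Nonempty (restrSheaf (consRow a) β ≅ hypSheaf (fun i => (a i : ℤ)) β) := by
  have iso := nonempty_restrSheaf_iso_hypSheaf (β := β) (m := 0) ha hS
    (fun j hj => absurd hj j.not_lt_zero) (by simpa only [Nat.cast_zero, add_zero] using hβ)
  rwa [Nat.cast_zero, add_zero] at iso

theorem nonempty_restrSheaf_natCast_iso_hypSheaf (ha : ∀ i, 0 < a i) {c : ℕ}
    (hc : ∀ j ≥ c, j ∈ AddSubmonoid.closure (Set.range a)) (k : ℕ) :
    Nonempty (restrSheaf (consRow a) k ≅ hypSheaf (fun i => (a i : ℤ)) (k + c)) := by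
  refine nonempty_restrSheaf_iso_hypSheaf ha (eventually_atTop.2 ⟨c, hc⟩) ?_ ?_ <;> norm_cast
  · exact fun j hj => (Nat.lt_add_left k hj).ne'
  · exact fun j hj hkj => hj (hc j (hkj ▸ Nat.le_add_left c k))

theorem exists_forall_ge_mem_closure_range (hgcd : Finset.univ.gcd (fun i => (a i : ℤ)) = 1) :
    ∃ c, ∀ j ≥ c, j ∈ AddSubmonoid.closure (Set.range a) := by
  have setGcd_eq_one : Nat.setGcd (Set.range a) = 1 := by
    rw [← Nat.dvd_one, ← Int.natCast_dvd_natCast, Nat.cast_one, ← hgcd]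
    exact Finset.dvd_gcd fun i _ =>
      Int.natCast_dvd_natCast.2 (Nat.setGcd_dvd_of_mem (Set.mem_range_self i))
  obtain ⟨c, hc⟩ := Nat.exists_mem_closure_of_ge (Set.range a)
  exact ⟨c, fun j hj => hc j hj (setGcd_eq_one ▸ one_dvd j)⟩

end Isomorphism

end HolD

end

theorem mainTheorem5_general {n : ℕ} (a : Fin n → ℤ) (ha : ∀ i, 0 < a i)
    (hgcd : Finset.univ.gcd a = 1) :
    ∃ b : ℂ → ℂ,
      (∀ β : ℂ, Nonempty
        (HolD.restrSheaf (Fin.cons 1 a : Fin (n + 1) → ℤ) β ≅ HolD.hypSheaf a (b β))) ∧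
      {β : ℂ | b β ≠ β}.Finite := by
  classical
  lift a to Fin n → ℕ using fun i => (ha i).le
  replace ha (i : Fin n) : 0 < a i := Int.natCast_pos.1 (ha i)
  have cons_eq : (Fin.cons 1 fun i => (a i : ℤ) : Fin (n + 1) → ℤ) = HolD.consRow a :=
    funext (Fin.cases rfl fun _ => rfl)
  obtain ⟨c, hc⟩ := HolD.exists_forall_ge_mem_closure_range hgcd
  let gaps : Set ℂ := Nat.cast '' {j | j ∉ AddSubmonoid.closure (Set.range a)}
  have gaps_finite : gaps.Finite := .image _ <| (Set.finite_Iio c).subset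
    fun (j : ℕ) hj => not_le.1 fun hcj => hj (hc j hcj)
  refine ⟨fun β => if β ∈ gaps then β + c else β, fun β => ?_,
    gaps_finite.subset fun β => not_imp_comm.1 (if_neg ·)⟩
  rw [cons_eq]
  by_cases hβ : β ∈ gaps
  · simp only [if_pos hβ]
    obtain ⟨k, -, rfl⟩ := hβ
    exact HolD.nonempty_restrSheaf_natCast_iso_hypSheaf ha hc k
  · simp only [if_neg hβ]
    exact HolD.nonempty_restrSheaf_iso_hypSheaf_of_not_gap ha (eventually_atTop.2 ⟨c, hc⟩)
      fun j hj hβj => hβ ⟨j, hj, hβj.symm⟩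

theorem mainTheorem5 (n : ℕ) (a : Fin n → ℤ) (ha : StrictMono a) (ha1 : ∀ i, 1 < a i)
    (hgcd : Finset.univ.gcd a = 1) :
    ∃ b : ℂ → ℂ,
      (∀ β : ℂ, Nonempty
        (HolD.restrSheaf (Fin.cons 1 a : Fin (n + 1) → ℤ) β ≅ HolD.hypSheaf a (b β))) ∧
      {β : ℂ | b β ≠ β}.Finite :=
  mainTheorem5_general a (fun i => one_pos.trans (ha1 i)) hgcd
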